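/- Let $a=(01)(\mathrm{id},\mathrm{id},a)$, $b=(02)(\mathrm{id},b,\mathrm{id})$, $c=(12)(c,\mathrm{id},\mathrm{id})$ be the generators of the Hanoi Towers group $H^{(3)}$, acting on the finite words over $\{0,1,2\}$: $a$ (respectively $b$, $c$) exchanges $0\leftrightarrow 1$ (respectively $0\leftrightarrow 2$, $1\leftrightarrow 2$) at the first letter different from $2$ (respectively $1$, $0$), and fixes a word that has no such letter. For $n\ge 1$ let $\Sigma_n$ be the Schreier graph of the action on words of length $n$, considered without its loops: its vertices are the words of length $n$, and two distinct words are joined by an edge if one of $a,b,c$ maps one to the other. The outmost vertices of $\Sigma_n$ are $0^n,1^n,2^n$. For a spanning subgraph $A$ of $\Sigma_n$ with $k(A)$ connected components put $r(A)=3^n-k(A)$ and $n(A)=|E(A)|-r(A)$. The Tutte polynomial of $\Sigma_n$ is $$H_n(x,y)=\sum_{A}(x-1)^{r(\Sigma_n)-r(A)}(y-1)^{n(A)}\in\mathbb Z[x,y],$$ the sum being over all spanning subgraphs $A$ of $\Sigma_n$. Let $H_{2,n}(x,y)$ and $H_{0,n}(x,y)$ be the same sum restricted to those $A$ in which the three outmost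 vertices lie in one connected component, respectively in three different connected components. For each $k\in\{0,1,2\}$ let $H_{1,n}^{(k)}(x,y)$ be the same sum restricted to those $A$ in which the two outmost vertices other than $k^n$ lie in one connected component and $k^n$ lies in a different one. Then, for every $n\ge 1$, there are polynomials $N_n,M_n\in\mathbb Z[x,y]$ (clearly unique) with $H_{1,n}^{(k)}=(x-1)N_n$ for each $k\in\{0,1,2\}$ and $H_{0,n}=(x-1)^2M_n$, and the following holds. For every $n\geq 1$ the number of acyclic orientations of $\Sigma_n$ (orientations of its edges without oriented cycles) is $H_n(2,0)$. For every $n\ge 1$, $$H_{n+1}(2,0)=\bigl(2H_n(2,0)\bigr)^3-2\bigl(H_{2,n}(2,0)+N_n(2,0)\bigr)^3$$ and, all polynomials being evaluated at $(2,0)$, $$H_{2,n+1}=2H_{2,n}^3+12H_{2,n}^2N_n+6H_{2,n}N_n^2,$$ $$N_{n+1}=H_{2,n}^3+11H_{2,n}^2N_n+4H_{2,n}^2M_n+28H_{2,n}N_n^2+8H_{2,n}N_nM_n+14N_n^3+4N_n^2M_n,$$ $$\begin{aligned}M_{n+1}={}&H_{2,n}^3+21H_{2,n}^2N_n+12H_{2,n}^2M_n+120H_{2,n}N_n^2+120H_{2,n}N_nM_n+24H_{2,n}M_n^2\\&+172N_n^3+204N_n^2M_n+72N_nM_n^2+8M_n^3,\end{aligned}$$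 with initial conditions $H_{2,1}(2,0)=2$ and $N_1(2,0)=M_1(2,0)=1$. -/

import Mathlib

open MvPolynomial

/-! ### Rank, nullity and the Tutte polynomial of a finite simple graph -/

section Tutte

variable {V : Type} [Fintype V]

/-- The rank `r(A) = |V(A)| - k(A)`, where `k(A)` is the number of connected components
(there are at most `|V(A)|` of them, so the subtraction is a true one). -/
noncomputable def graphRank (A : SimpleGraph V) : ℕ :=
  Fintype.card V - Nat.card A.ConnectedComponent

/-- The nullity `n(A) = |E(A)| - r(A)` (one always has `r(A) ≤ |E(A)|`). -/
noncomputable def graphNullity (A : SimpleGraph V) : ℕ :=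
  A.edgeSet.ncard - graphRank A

/-- The finite set of all spanning subgraphs of `G` that have the property `P`. -/
noncomputable def spanningSubgraphs (G : SimpleGraph V) (P : SimpleGraph V → Prop) :
    Finset (SimpleGraph V) :=
  (Set.toFinite {A : SimpleGraph V | A ≤ G ∧ P A}).toFinset

/-- The sum of `(x - 1) ^ (r(G) - r(A)) * (y - 1) ^ n(A)` over the spanning subgraphs `A` of `G`
with the property `P`, as an element of `ℤ[x, y]`, where `x = X 0` and `y = X 1`. -/
noncomputable def partialTutte (G : SimpleGraph V) (P : SimpleGraph V → Prop) :
    MvPolynomial (Fin 2) ℤ :=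
  ∑ A ∈ spanningSubgraphs G P,
    (X 0 - 1) ^ (graphRank G - graphRank A) * (X 1 - 1) ^ graphNullity A

/-- The Tutte polynomial `T(G; x, y)`: the sum over all spanning subgraphs. -/
noncomputable def tuttePolynomial (G : SimpleGraph V) : MvPolynomial (Fin 2) ℤ :=
  partialTutte G fun _ => True

end Tutte

/-! ### Acyclic orientations -/

/-- `D` is an orientation of `G`: it chooses exactly one of the two directions of each edge of `G`,
and has no other arcs. -/
def IsOrientation {V : Type} (G : SimpleGraph V) (D : V → V → Prop) : Prop :=
  (∀ u v, G.Adj u v ↔ D u v ∨ D v u) ∧ ∀ u v, D u v → ¬ D v u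

/-- `D` has no oriented cycles: no vertex can be reached from itself by a nonempty directed walk. -/
def HasNoOrientedCycle {V : Type} (D : V → V → Prop) : Prop :=
  ∀ v, ¬ Relation.TransGen D v v

/-- The number of acyclic orientations of `G`. -/
noncomputable def numAcyclicOrientations {V : Type} (G : SimpleGraph V) : ℕ :=
  {D : V → V → Prop | IsOrientation G D ∧ HasNoOrientedCycle D}.ncard

/-! ### The Schreier graphs of the Hanoi Towers group -/

/-- The automorphism of the rooted ternary tree (whose vertices are the finite words over
`{0, 1, 2}`) that exchanges `i` and `j` at the root and has the identity as its section at `i` and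
at `j`, and itself as its section at the third letter. -/
def hanoiSwap (i j : Fin 3) : List (Fin 3) → List (Fin 3)
  | [] => []
  | x :: w => if x = i then j :: w else if x = j then i :: w else x :: hanoiSwap i j w

/-- The generator `a = (01)(id, id, a)`. -/
def hanoiA : List (Fin 3) → List (Fin 3) := hanoiSwap 0 1

/-- The generator `b = (02)(id, b, id)`. -/
def hanoiB : List (Fin 3) → List (Fin 3) := hanoiSwap 0 2

/-- The generator `c = (12)(c, id, id)`. -/
def hanoiC : List (Fin 3) → List (Fin 3) := hanoiSwap 1 2

theorem hanoiSwap_involutive (i j : Fin 3) : Function.Involutive (hanoiSwap i j) := by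
  intro w
  induction w with
  | nil => rfl
  | cons x w ih =>
    by_cases h1 : x = i
    · by_cases h3 : j = i <;> simp [hanoiSwap, h1, h3]
    · by_cases h2 : x = j
      · subst h2
        simp [hanoiSwap, h1]
      · simp [hanoiSwap, h1, h2, ih]

/-- The Schreier graph `Σ_n` of the Hanoi Towers group, without its loops: the vertices are the
words of length `n` over `{0, 1, 2}`, and two distinct words are joined if one of the generators
maps one to the other. (Two different generators never map a word to the same different word, so
there are no multiple edges to keep track of.) -/
def hanoiSchreier (n : ℕ) : SimpleGraph (List.Vector (Fin 3) n) where
  Adj u v := u ≠ v ∧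
    (hanoiA u.toList = v.toList ∨ hanoiB u.toList = v.toList ∨ hanoiC u.toList = v.toList)
  symm := ⟨by
    rintro u v ⟨huv, h⟩
    refine ⟨huv.symm, ?_⟩
    rcases h with h | h | h
    · exact Or.inl (by rw [← h]; exact hanoiSwap_involutive 0 1 _)
    · exact Or.inr (Or.inl (by rw [← h]; exact hanoiSwap_involutive 0 2 _))
    · exact Or.inr (Or.inr (by rw [← h]; exact hanoiSwap_involutive 1 2 _))⟩
  loopless := ⟨fun _ h => h.1 rfl⟩

/-- The outmost vertices `0^n` (leftmost), `1^n` (upmost) and `2^n` (rightmost) of `Σ_n`. -/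
def outmost (n : ℕ) (i : Fin 3) : List.Vector (Fin 3) n := List.Vector.replicate n i

/-- The three outmost vertices lie in the same connected component of `A`. -/
def TypeTwo (n : ℕ) (A : SimpleGraph (List.Vector (Fin 3) n)) : Prop :=
  ∀ i j, A.Reachable (outmost n i) (outmost n j)

/-- The two outmost vertices other than `k^n` lie in the same connected component of `A`, and `k^n`
lies in a different one. -/
def TypeOne (n : ℕ) (k : Fin 3) (A : SimpleGraph (List.Vector (Fin 3) n)) : Prop :=
  (∀ i j, i ≠ k → j ≠ k → A.Reachable (outmost n i) (outmost n j)) ∧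
    ∀ i, i ≠ k → ¬ A.Reachable (outmost n i) (outmost n k)

/-- The three outmost vertices lie in three different connected components of `A`. -/
def TypeZero (n : ℕ) (A : SimpleGraph (List.Vector (Fin 3) n)) : Prop :=
  ∀ i j, i ≠ j → ¬ A.Reachable (outmost n i) (outmost n j)

/-- The Tutte polynomial `H_n(x, y)` of `Σ_n`. -/
noncomputable def hanoiH (n : ℕ) : MvPolynomial (Fin 2) ℤ := tuttePolynomial (hanoiSchreier n)

/-- `H_{2,n}(x, y)`. -/
noncomputable def hanoiH2 (n : ℕ) : MvPolynomial (Fin 2) ℤ :=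
  partialTutte (hanoiSchreier n) (TypeTwo n)

/-- `H_{1,n}(x, y)`, where `k^n` is the separated outmost vertex; `k = 1`, `2`, `0` give
`H_{1,n}^u`, `H_{1,n}^r` and `H_{1,n}^l`. -/
noncomputable def hanoiH1 (n : ℕ) (k : Fin 3) : MvPolynomial (Fin 2) ℤ :=
  partialTutte (hanoiSchreier n) (TypeOne n k)

/-- `H_{0,n}(x, y)`. -/
noncomputable def hanoiH0 (n : ℕ) : MvPolynomial (Fin 2) ℤ :=
  partialTutte (hanoiSchreier n) (TypeZero n)

/-- The value `p(2, 0)` of a polynomial `p(x, y)`. -/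
noncomputable def at20 (p : MvPolynomial (Fin 2) ℤ) : ℤ := MvPolynomial.eval ![2, 0] p

/-! At `(2, 0)` the factor `x - 1` becomes `1` and `y - 1` becomes `-1`. Every restricted Tutte sum
is then a signed count of spanning subgraphs `A` with weight `(-1) ^ n(A)`, and `N_n`, `M_n` take
the same values as `H_{1,n}`, `H_{0,n}`.

The recursion comes from self-similarity. Sorting words by their last letter exhibits `Σ_{n+1}` as
three copies of `Σ_n`, each pair joined by one edge between corresponding corners
(`gluedGraph_adj_iff`). The sign is multiplicative over disjoint copies
(`nullitySign_disjointUnion`), and a further edge flips it exactly when its ends are already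
connected (`nullitySign_sup_edge`). Hence the joining edges see a subgraph of the copies only
through its sign and the partition it induces on the corners of each copy. There are five such
partitions, so the new sums are a trilinear form in the old ones, with coefficients given by a
finite computation (`stateSum_gluedGraph`, `kindCoeff_zero`, `kindCoeff_one`, `kindCoeff_four`).
Permuting letters gives automorphisms of `Σ_n`, so the three two-class partitions have equal weight
(`hanoiH1_eq`) and three unknowns remain. Since the recursion also holds from the one-vertex graph
`Σ_0`, it yields the initial values.

The count of acyclic orientations is Stanley's theorem. The induction of deletion and contraction
runs over a pair of graphs `G`, `B` on the same vertices, with the edges of `B` regarded as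
contracted, so that no quotient graph is formed (`sum_subgraphs_eq_acyclicModulo`).

Divisibility by powers of `x - 1` holds because `Σ_n` is connected, so that the exponent is `k(A) -
1` (`exists_partialTutte_eq_mul`). -/

namespace SimpleGraph

/-! ### Adding one edge: reachability, components, edge count. -/

variable {V : Type}

theorem reachable_sup_edge_iff (A : SimpleGraph V) (u v x y : V) :
    (A ⊔ edge u v).Reachable x y ↔ A.Reachable x y ∨ (A.Reachable x u ∧ A.Reachable v y) ∨
      (A.Reachable x v ∧ A.Reachable u y) := by
  have hle : A ≤ A ⊔ edge u v := le_sup_left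
  have huv : (A ⊔ edge u v).Reachable u v := by
    by_cases h : u = v
    · subst h; rfl
    · exact Adj.reachable (by simp [edge_adj, h])
  constructor
  · rintro ⟨p⟩
    induction p with
    | nil => exact Or.inl (Reachable.refl _)
    | @cons a b c hab p ih =>
      rw [sup_adj, edge_adj] at hab
      rcases hab with hab | ⟨⟨rfl, rfl⟩ | ⟨rfl, rfl⟩, -⟩
      · have h := hab.reachable
        rcases ih with ih | ⟨h1, h2⟩ | ⟨h1, h2⟩
        · exact Or.inl (h.trans ih)
        · exact Or.inr (Or.inl ⟨h.trans h1, h2⟩)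
        · exact Or.inr (Or.inr ⟨h.trans h1, h2⟩)
      · rcases ih with ih | ⟨h1, h2⟩ | ⟨h1, h2⟩
        · exact Or.inr (Or.inl ⟨Reachable.refl _, ih⟩)
        · exact Or.inr (Or.inl ⟨Reachable.refl _, h2⟩)
        · exact Or.inl h2
      · rcases ih with ih | ⟨h1, h2⟩ | ⟨h1, h2⟩
        · exact Or.inr (Or.inr ⟨Reachable.refl _, ih⟩)
        · exact Or.inl h2
        · exact Or.inr (Or.inr ⟨Reachable.refl _, h2⟩)
  · rintro (h | ⟨h1, h2⟩ | ⟨h1, h2⟩)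
    · exact h.mono hle
    · exact (h1.mono hle).trans (huv.trans (h2.mono hle))
    · exact (h1.mono hle).trans (huv.symm.trans (h2.mono hle))

theorem card_connectedComponent_sup_edge_of_reachable (A : SimpleGraph V) {u v : V}
    (h : A.Reachable u v) :
    Nat.card (A ⊔ edge u v).ConnectedComponent = Nat.card A.ConnectedComponent := by
  refine (Nat.card_congr (Equiv.ofBijective
    (ConnectedComponent.map (Hom.ofLE (le_sup_left : A ≤ A ⊔ edge u v)))
    ⟨?_, ConnectedComponent.surjective_map_ofLE le_sup_left⟩)).symm
  intro c d
  induction c, d using ConnectedComponent.ind₂ with | _ x y =>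
  intro hxy
  simp only [ConnectedComponent.map_mk, Hom.ofLE_apply, ConnectedComponent.eq] at hxy ⊢
  rcases (reachable_sup_edge_iff A u v x y).1 hxy with h' | ⟨h1, h2⟩ | ⟨h1, h2⟩
  · exact h'
  · exact h1.trans (h.trans h2)
  · exact h1.trans (h.symm.trans h2)

/-- The new edge merges the class of `v` into that of `u`, so the classes other than that of `v`
biject with the classes of the larger graph. -/
theorem card_connectedComponent_sup_edge_of_not_reachable [Finite V] (A : SimpleGraph V) {u v : V}
    (h : ¬ A.Reachable u v) :
    Nat.card (A ⊔ edge u v).ConnectedComponent + 1 = Nat.card A.ConnectedComponent := by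
  classical
  have key : Function.Bijective
      (fun c : {c : A.ConnectedComponent // c ≠ A.connectedComponentMk v} =>
        ConnectedComponent.map (Hom.ofLE (le_sup_left : A ≤ A ⊔ edge u v)) c.1) := by
    constructor
    · rintro ⟨c, hc⟩ ⟨d, hd⟩
      induction c, d using ConnectedComponent.ind₂ with | _ x y =>
      intro hxy
      simp only [ConnectedComponent.map_mk, Hom.ofLE_apply, ConnectedComponent.eq, ne_eq,
        Subtype.mk.injEq] at hxy hc hd ⊢
      rcases (reachable_sup_edge_iff A u v x y).1 hxy with h' | ⟨h1, h2⟩ | ⟨h1, h2⟩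
      · exact h'
      · exact absurd h2.symm hd
      · exact absurd h1 hc
    · intro c
      induction c using ConnectedComponent.ind with | _ x =>
      by_cases hx : A.Reachable x v
      · refine ⟨⟨A.connectedComponentMk u, by simpa using h⟩, ?_⟩
        simp only [ConnectedComponent.map_mk, Hom.ofLE_apply, ConnectedComponent.eq]
        exact (reachable_sup_edge_iff A u v u x).2 (Or.inr (Or.inl ⟨Reachable.refl _, hx.symm⟩))
      · exact ⟨⟨A.connectedComponentMk x, by simpa using hx⟩, rfl⟩
  rw [← Nat.card_congr (Equiv.ofBijective _ key), ← Finite.card_option]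
  exact Nat.card_congr (Equiv.optionSubtypeNe _)

theorem edgeSet_ncard_sup_edge [Finite V] (A : SimpleGraph V) {u v : V} (huv : u ≠ v)
    (h : ¬ A.Adj u v) : (A ⊔ edge u v).edgeSet.ncard = A.edgeSet.ncard + 1 := by
  have : (A ⊔ edge u v).edgeSet = insert s(u, v) A.edgeSet := by
    ext e
    induction e with | _ x y =>
    simp only [mem_edgeSet, sup_adj, edge_adj, Set.mem_insert_iff, Sym2.eq_iff]
    constructor
    · tauto
    · rintro ((⟨rfl, rfl⟩ | ⟨rfl, rfl⟩) | h')
      · exact Or.inr ⟨Or.inl ⟨rfl, rfl⟩, huv⟩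
      · exact Or.inr ⟨Or.inr ⟨rfl, rfl⟩, huv.symm⟩
      · exact Or.inl h'
  rw [this, Set.ncard_insert_of_notMem (by simpa using h) (Set.toFinite _)]

theorem induction_sup_edge [Finite V] {motive : SimpleGraph V → Prop} (bot : motive ⊥)
    (sup_edge : ∀ (A : SimpleGraph V) (u v : V), u ≠ v → ¬ A.Adj u v → motive A →
      motive (A ⊔ edge u v)) (G : SimpleGraph V) : motive G := by
  induction G using WellFoundedLT.induction with | _ G ih =>
  by_cases hG : G = ⊥
  · rw [hG]; exact bot
  · obtain ⟨u, v, huv⟩ := ne_bot_iff_exists_adj.1 hG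
    have hsup : G \ edge u v ⊔ edge u v = G := by
      rw [sdiff_sup_self, sup_eq_left]
      exact (edge_le_iff _).2 (Or.inr huv)
    have hn : ¬ (G \ edge u v).Adj u v := by simp [sdiff_adj, edge_adj, huv.ne]
    rw [← hsup]
    refine sup_edge _ u v huv.ne hn (ih _ (lt_of_le_of_ne sdiff_le ?_))
    intro h
    rw [h] at hn
    exact hn huv

/-- Each added edge lowers the number of components by at most one. This bound makes the natural
subtraction in `graphNullity` a true one. -/
theorem card_le_edgeSet_ncard_add_card_connectedComponent [Fintype V] (A : SimpleGraph V) :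
    Fintype.card V ≤ A.edgeSet.ncard + Nat.card A.ConnectedComponent := by
  induction A using induction_sup_edge with
  | bot =>
    have : Function.Injective (⊥ : SimpleGraph V).connectedComponentMk := by
      intro x y h
      simpa using h
    simpa using Nat.card_le_card_of_injective _ this
  | sup_edge A u v huv h ih =>
    rw [edgeSet_ncard_sup_edge A huv h]
    by_cases hr : A.Reachable u v
    · rw [card_connectedComponent_sup_edge_of_reachable A hr]; omega
    · have := card_connectedComponent_sup_edge_of_not_reachable A hr
      omega

theorem card_connectedComponent_le [Fintype V] (A : SimpleGraph V) :
    Nat.card A.ConnectedComponent ≤ Fintype.card V := by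
  rw [← Nat.card_eq_fintype_card]
  exact Nat.card_le_card_of_surjective A.connectedComponentMk Quot.mk_surjective

end SimpleGraph

open SimpleGraph

/-! ### The Tutte sums at `(2, 0)` as signed counts. -/

section Weight

variable {V : Type} [Fintype V]

/-- The sign `(-1) ^ n(A)`, the weight of `A` in the Tutte polynomial at `(2, 0)`. -/
noncomputable def nullitySign (A : SimpleGraph V) : ℤ := (-1) ^ graphNullity A

theorem graphNullity_add_card (A : SimpleGraph V) :
    graphNullity A + Fintype.card V = A.edgeSet.ncard + Nat.card A.ConnectedComponent := by
  have h1 := card_le_edgeSet_ncard_add_card_connectedComponent A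
  have h2 := card_connectedComponent_le A
  unfold graphNullity graphRank
  omega

theorem nullitySign_eq (A : SimpleGraph V) :
    nullitySign A =
      (-1) ^ Fintype.card V * (-1) ^ (A.edgeSet.ncard + Nat.card A.ConnectedComponent) := by
  rw [nullitySign, ← graphNullity_add_card A, pow_add, mul_comm, mul_assoc, ← mul_pow]
  simp

theorem nullitySign_bot : nullitySign (⊥ : SimpleGraph V) = 1 := by
  simp [nullitySign, graphNullity]

-- An edge inside a component closes a cycle and raises the nullity by one; an edge between two
-- components raises the rank instead.
open Classical in
theorem nullitySign_sup_edge (A : SimpleGraph V) {u v : V} (huv : u ≠ v) (h : ¬ A.Adj u v) :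
    nullitySign (A ⊔ edge u v) = nullitySign A * if A.Reachable u v then -1 else 1 := by
  rw [nullitySign_eq, nullitySign_eq, edgeSet_ncard_sup_edge A huv h]
  split_ifs with hr
  · rw [card_connectedComponent_sup_edge_of_reachable A hr]
    ring
  · rw [← card_connectedComponent_sup_edge_of_not_reachable A hr]
    ring

/-- The finite set of all spanning subgraphs of `G`. -/
noncomputable def subgraphs (G : SimpleGraph V) : Finset (SimpleGraph V) :=
  (Set.toFinite {A : SimpleGraph V | A ≤ G}).toFinset

@[simp] theorem mem_subgraphs {G A : SimpleGraph V} : A ∈ subgraphs G ↔ A ≤ G := by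
  simp [subgraphs]

@[simp] theorem mem_spanningSubgraphs {G A : SimpleGraph V} {P : SimpleGraph V → Prop} :
    A ∈ spanningSubgraphs G P ↔ A ≤ G ∧ P A := by
  simp [spanningSubgraphs]

theorem subgraphs_bot : subgraphs (⊥ : SimpleGraph V) = {⊥} := by
  ext A; simp

/-- Subgraphs of the larger graph are sorted by whether they contain the new edge. -/
theorem sum_subgraphs_sup_edge {M : Type*} [AddCommMonoid M] (G : SimpleGraph V) {u v : V}
    (huv : u ≠ v) (h : ¬ G.Adj u v) (f : SimpleGraph V → M) :
    ∑ A ∈ subgraphs (G ⊔ edge u v), f A = ∑ A ∈ subgraphs G, (f A + f (A ⊔ edge u v)) := by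
  classical
  have hn : ∀ {A}, A ≤ G → ¬ A.Adj u v := fun hA h' => h (hA h')
  have hinj : Set.InjOn (fun A => A ⊔ edge u v) (subgraphs G : Set (SimpleGraph V)) := by
    intro A hA B hB hAB
    simp only [Finset.mem_coe, mem_subgraphs] at hA hB
    have := congrArg (· \ edge u v) hAB
    simpa [sup_sdiff_right_self, sdiff_edge _ (hn hA), sdiff_edge _ (hn hB)] using this
  have hunion : subgraphs (G ⊔ edge u v) =
      subgraphs G ∪ (subgraphs G).image (fun A => A ⊔ edge u v) := by
    ext A
    simp only [Finset.mem_union, mem_subgraphs, Finset.mem_image]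
    constructor
    · intro hA
      by_cases hadj : A.Adj u v
      · refine Or.inr ⟨A \ edge u v, ?_, ?_⟩
        · rwa [sdiff_le_iff, sup_comm]
        · rw [sdiff_sup_self, sup_eq_left]
          exact (edge_le_iff _).2 (Or.inr hadj)
      · left
        rw [← sdiff_edge _ hadj, sdiff_le_iff, sup_comm]
        exact hA
    · rintro (hA | ⟨B, hB, rfl⟩)
      · exact hA.trans le_sup_left
      · exact sup_le_sup_right hB _
  have hdisj : Disjoint (subgraphs G) ((subgraphs G).image (fun A => A ⊔ edge u v)) := by
    rw [Finset.disjoint_left]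
    intro A hA hA'
    simp only [mem_subgraphs, Finset.mem_image] at hA hA'
    obtain ⟨B, -, rfl⟩ := hA'
    exact hn hA (by simp [edge_adj, huv])
  rw [hunion, Finset.sum_union hdisj, Finset.sum_image hinj, Finset.sum_add_distrib]

open Classical in
theorem at20_partialTutte (G : SimpleGraph V) (P : SimpleGraph V → Prop) :
    at20 (partialTutte G P) = ∑ A ∈ subgraphs G, if P A then nullitySign A else 0 := by
  rw [← Finset.sum_filter]
  have : spanningSubgraphs G P = (subgraphs G).filter P := by ext; simp
  rw [at20, partialTutte, this, map_sum]
  refine Finset.sum_congr rfl fun A _ => ?_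
  simp [nullitySign]

end Weight

/-! ### Acyclic orientations and deletion-contraction. -/

section AcyclicOrientations

variable {V : Type}

/-- The relation `D ∪ B` of a digraph `D` together with both directions of the edges of `B`. -/
def mixedStep (D : V → V → Prop) (B : SimpleGraph V) (x y : V) : Prop := D x y ∨ B.Adj x y

/-- No arc of `D` lies on a directed cycle of the mixed graph `D ∪ B`: the orientation that `D`
induces after contracting the edges of `B` is acyclic. -/
def AcyclicModulo (D : V → V → Prop) (B : SimpleGraph V) : Prop :=
  ∀ x y, D x y → ¬ Relation.ReflTransGen (mixedStep D B) y x

/-- Adding the arc `(u, v)` to `D`. -/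
def addArc (D : V → V → Prop) (u v : V) (x y : V) : Prop := D x y ∨ (x = u ∧ y = v)

theorem acyclicModulo_bot (D : V → V → Prop) : AcyclicModulo D ⊥ ↔ HasNoOrientedCycle D := by
  have : mixedStep D ⊥ = D := by
    funext x y; simp [mixedStep]
  unfold AcyclicModulo HasNoOrientedCycle
  rw [this]
  constructor
  · intro h v hv
    obtain ⟨w, hvw, hwv⟩ := Relation.TransGen.head'_iff.1 hv
    exact h v w hvw hwv
  · intro h x y hxy hyx
    exact h x (Relation.TransGen.head' hxy hyx)

theorem reflTransGen_addArc {D : V → V → Prop} {B : SimpleGraph V} {u v x y : V} :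
    Relation.ReflTransGen (mixedStep (addArc D u v) B) x y ↔
      Relation.ReflTransGen (mixedStep D B) x y ∨
        (Relation.ReflTransGen (mixedStep D B) x u ∧
          Relation.ReflTransGen (mixedStep D B) v y) := by
  have hmono : ∀ {a b}, Relation.ReflTransGen (mixedStep D B) a b →
      Relation.ReflTransGen (mixedStep (addArc D u v) B) a b := fun h =>
    Relation.ReflTransGen.mono (fun _ _ h => h.imp Or.inl id) _ _ h
  constructor
  · intro h
    induction h with
    | refl => exact Or.inl Relation.ReflTransGen.refl
    | tail _ hbc ih =>
      rcases hbc with (hbc | ⟨rfl, rfl⟩) | hbc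
      · exact ih.imp (fun h => h.tail (Or.inl hbc)) fun h => ⟨h.1, h.2.tail (Or.inl hbc)⟩
      · exact Or.inr ⟨ih.elim id And.left, Relation.ReflTransGen.refl⟩
      · exact ih.imp (fun h => h.tail (Or.inr hbc)) fun h => ⟨h.1, h.2.tail (Or.inr hbc)⟩
  · rintro (h | ⟨h1, h2⟩)
    · exact hmono h
    · exact ((hmono h1).tail (Or.inl (Or.inr ⟨rfl, rfl⟩))).trans (hmono h2)

/-- An undirected edge amounts to a pair of opposite arcs; a walk that uses both can be shortened.
-/
theorem reflTransGen_mixedStep_sup_edge {D : V → V → Prop} {B : SimpleGraph V} {u v x y : V}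
    (huv : u ≠ v) :
    Relation.ReflTransGen (mixedStep D (B ⊔ edge u v)) x y ↔
      Relation.ReflTransGen (mixedStep D B) x y ∨
        (Relation.ReflTransGen (mixedStep D B) x u ∧
          Relation.ReflTransGen (mixedStep D B) v y) ∨
        (Relation.ReflTransGen (mixedStep D B) x v ∧
          Relation.ReflTransGen (mixedStep D B) u y) := by
  have hstep : mixedStep D (B ⊔ edge u v) = mixedStep (addArc (addArc D u v) v u) B := by
    funext a b
    simp only [mixedStep, addArc, sup_adj, edge_adj, eq_iff_iff]
    constructor
    · tauto
    · rintro (((h | ⟨rfl, rfl⟩) | ⟨rfl, rfl⟩) | h)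
      · exact Or.inl h
      · exact Or.inr (Or.inr ⟨Or.inl ⟨rfl, rfl⟩, huv⟩)
      · exact Or.inr (Or.inr ⟨Or.inr ⟨rfl, rfl⟩, huv.symm⟩)
      · exact Or.inr (Or.inl h)
  rw [hstep]
  simp only [reflTransGen_addArc]
  constructor
  · rintro ((h | h) | ⟨h1 | h1, h2 | h2⟩)
    · exact Or.inl h
    · exact Or.inr (Or.inl h)
    · exact Or.inr (Or.inr ⟨h1, h2⟩)
    · exact Or.inl (h1.trans h2.2)
    · exact Or.inl (h1.1.trans h2)
    · exact Or.inr (Or.inl ⟨h1.1, h2.2⟩)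
  · tauto

theorem acyclicModulo_addArc {D : V → V → Prop} {B : SimpleGraph V} {u v : V} :
    AcyclicModulo (addArc D u v) B ↔
      AcyclicModulo D B ∧ ¬ Relation.ReflTransGen (mixedStep D B) v u := by
  unfold AcyclicModulo
  simp only [reflTransGen_addArc]
  constructor
  · intro h
    exact ⟨fun x y hxy hyx => h x y (Or.inl hxy) (Or.inl hyx),
      fun hvu => h u v (Or.inr ⟨rfl, rfl⟩) (Or.inl hvu)⟩
  · rintro ⟨h, hvu⟩ x y (hxy | ⟨rfl, rfl⟩) (hyx | ⟨h1, h2⟩)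
    · exact h x y hxy hyx
    · exact hvu (h2.trans (h1.head (Or.inl hxy)))
    · exact hvu hyx
    · exact hvu h1

theorem reachable_of_reflTransGen {D : V → V → Prop} {B : SimpleGraph V} {x y : V}
    (h : Relation.ReflTransGen (mixedStep D B) x y) :
    B.Reachable x y ∨ ∃ a b, D a b ∧ Relation.ReflTransGen (mixedStep D B) x a ∧
      Relation.ReflTransGen (mixedStep D B) b y := by
  induction h with
  | refl => exact Or.inl (Reachable.refl _)
  | tail hab hbc ih =>
    rcases hbc with hbc | hbc
    · exact Or.inr ⟨_, _, hbc, hab, Relation.ReflTransGen.refl⟩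
    · rcases ih with ih | ⟨a, b, h1, h2, h3⟩
      · exact Or.inl (ih.trans hbc.reachable)
      · exact Or.inr ⟨a, b, h1, h2, h3.tail (Or.inr hbc)⟩

theorem reflTransGen_of_reachable {D : V → V → Prop} {B : SimpleGraph V} {x y : V}
    (h : B.Reachable x y) : Relation.ReflTransGen (mixedStep D B) x y := by
  obtain ⟨p⟩ := h
  induction p with
  | nil => exact Relation.ReflTransGen.refl
  | cons hab _ ih => exact ih.head (Or.inr hab)

/-- Since `B` alone does not connect `u` and `v`, a mixed walk between them uses an arc of `D`;
identifying its ends closes a cycle through that arc. -/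
theorem acyclicModulo_sup_edge {D : V → V → Prop} {B : SimpleGraph V} {u v : V}
    (h : ¬ B.Reachable u v) :
    AcyclicModulo D (B ⊔ edge u v) ↔
      AcyclicModulo D B ∧ ¬ Relation.ReflTransGen (mixedStep D B) u v ∧
        ¬ Relation.ReflTransGen (mixedStep D B) v u := by
  have huv : u ≠ v := by rintro rfl; exact h (Reachable.refl _)
  unfold AcyclicModulo
  simp only [reflTransGen_mixedStep_sup_edge huv]
  constructor
  · intro hD
    refine ⟨fun x y hxy hyx => hD x y hxy (Or.inl hyx), fun hr => ?_, fun hr => ?_⟩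
    · obtain h' | ⟨a, b, hab, h1, h2⟩ := reachable_of_reflTransGen hr
      · exact h h'
      · exact hD a b hab (Or.inr (Or.inr ⟨h2, h1⟩))
    · obtain h' | ⟨a, b, hab, h1, h2⟩ := reachable_of_reflTransGen hr
      · exact h h'.symm
      · exact hD a b hab (Or.inr (Or.inl ⟨h2, h1⟩))
  · rintro ⟨hD, huv, hvu⟩ x y hxy (hyx | ⟨h1, h2⟩ | ⟨h1, h2⟩)
    · exact hD x y hxy hyx
    · exact hvu (h2.trans (h1.head (Or.inl hxy)))
    · exact huv (h2.trans (h1.head (Or.inl hxy)))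

theorem AcyclicModulo.not_reflTransGen_both {D : V → V → Prop} {B : SimpleGraph V} {u v : V}
    (hD : AcyclicModulo D B) (h : ¬ B.Reachable u v)
    (huv : Relation.ReflTransGen (mixedStep D B) u v) :
    ¬ Relation.ReflTransGen (mixedStep D B) v u := by
  intro hvu
  obtain h' | ⟨a, b, hab, h1, h2⟩ := reachable_of_reflTransGen huv
  · exact h h'
  · exact hD a b hab (h2.trans (hvu.trans h1))

theorem IsOrientation.withArc {G : SimpleGraph V} {D : V → V → Prop} {u v : V}
    (hD : IsOrientation G D) (huv : u ≠ v) (h : ¬ G.Adj u v) :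
    IsOrientation (G ⊔ edge u v) (addArc D u v) := by
  obtain ⟨h1, h2⟩ := hD
  refine ⟨fun x y => ?_, fun x y => ?_⟩
  · simp only [sup_adj, edge_adj, h1, addArc]
    constructor
    · tauto
    · rintro ((h | ⟨rfl, rfl⟩) | (h | ⟨rfl, rfl⟩))
      · tauto
      · exact Or.inr ⟨Or.inl ⟨rfl, rfl⟩, huv⟩
      · tauto
      · exact Or.inr ⟨Or.inr ⟨rfl, rfl⟩, huv.symm⟩
  · rintro (hxy | ⟨rfl, rfl⟩) (hyx | ⟨rfl, h'⟩)
    · exact h2 _ _ hxy hyx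
    · subst h'; exact h ((h1 _ _).2 (Or.inr hxy))
    · exact h ((h1 _ _).2 (Or.inr hyx))
    · exact huv h'

theorem IsOrientation.exists_eq_addArc {G : SimpleGraph V} {D : V → V → Prop} {u v : V}
    (hD : IsOrientation (G ⊔ edge u v) D) (h : ¬ G.Adj u v) (huv : D u v) :
    ∃ D', IsOrientation G D' ∧ D = addArc D' u v := by
  obtain ⟨h1, h2⟩ := hD
  refine ⟨fun x y => D x y ∧ ¬ (x = u ∧ y = v), ⟨fun x y => ?_, fun x y hx hy =>
    h2 _ _ hx.1 hy.1⟩, ?_⟩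
  · constructor
    · intro hG
      have h3 : ¬ (x = u ∧ y = v) := by rintro ⟨rfl, rfl⟩; exact h hG
      have h4 : ¬ (y = u ∧ x = v) := by rintro ⟨rfl, rfl⟩; exact h hG.symm
      exact ((h1 x y).1 (Or.inl hG)).imp (fun h => ⟨h, h3⟩) (fun h => ⟨h, h4⟩)
    · rintro (⟨h3, h4⟩ | ⟨h3, h4⟩)
      · rcases (h1 x y).2 (Or.inl h3) with h5 | h5
        · exact h5
        · rcases (edge_adj _ _ _ _).1 h5 with ⟨⟨rfl, rfl⟩ | ⟨rfl, rfl⟩, -⟩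
          · exact absurd ⟨rfl, rfl⟩ h4
          · exact absurd h3 (h2 _ _ huv)
      · rcases (h1 x y).2 (Or.inr h3) with h5 | h5
        · exact h5
        · rcases (edge_adj _ _ _ _).1 h5 with ⟨⟨rfl, rfl⟩ | ⟨rfl, rfl⟩, -⟩
          · exact absurd h3 (h2 _ _ huv)
          · exact absurd ⟨rfl, rfl⟩ h4
  · funext x y
    simp only [addArc, eq_iff_iff]
    constructor
    · tauto
    · rintro (h | ⟨rfl, rfl⟩)
      · exact h.1
      · exact huv

theorem addArc_injOn {G : SimpleGraph V} {u v : V} (h : ¬ G.Adj u v) :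
    Set.InjOn (fun D => addArc D u v) {D : V → V → Prop | IsOrientation G D} := by
  intro D hD D' hD' heq
  have hn : ∀ {E : V → V → Prop}, IsOrientation G E → ¬ E u v :=
    fun hE hE' => h ((hE.1 _ _).2 (Or.inl hE'))
  funext x y
  have := congrFun (congrFun heq x) y
  simp only [addArc, eq_iff_iff] at this ⊢
  by_cases hxy : x = u ∧ y = v
  · obtain ⟨rfl, rfl⟩ := hxy
    exact iff_of_false (hn hD) (hn hD')
  · simpa [hxy] using this

variable [Fintype V]

/-- The finite set of all orientations of `G`. -/
noncomputable def orientations (G : SimpleGraph V) : Finset (V → V → Prop) :=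
  (Set.toFinite {D : V → V → Prop | IsOrientation G D}).toFinset

@[simp] theorem mem_orientations {G : SimpleGraph V} {D : V → V → Prop} :
    D ∈ orientations G ↔ IsOrientation G D := by
  simp [orientations]

/-- An orientation of the larger graph is an orientation of `G` together with a direction of the new
edge. -/
theorem sum_orientations_sup_edge {M : Type*} [AddCommMonoid M] (G : SimpleGraph V) {u v : V}
    (huv : u ≠ v) (h : ¬ G.Adj u v) (f : (V → V → Prop) → M) :
    ∑ D ∈ orientations (G ⊔ edge u v), f D =
      ∑ D ∈ orientations G, (f (addArc D u v) + f (addArc D v u)) := by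
  classical
  have h' : ¬ G.Adj v u := fun hG => h hG.symm
  have hunion : orientations (G ⊔ edge u v) =
      (orientations G).image (fun D => addArc D u v) ∪
        (orientations G).image (fun D => addArc D v u) := by
    ext D
    simp only [Finset.mem_union, mem_orientations, Finset.mem_image]
    constructor
    · intro hD
      rcases (hD.1 u v).1 (by simp [edge_adj, huv]) with hD' | hD'
      · obtain ⟨E, hE, rfl⟩ := hD.exists_eq_addArc h hD'
        exact Or.inl ⟨E, hE, rfl⟩
      · rw [edge_comm] at hD
        obtain ⟨E, hE, rfl⟩ := hD.exists_eq_addArc h' hD'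
        exact Or.inr ⟨E, hE, rfl⟩
    · rintro (⟨E, hE, rfl⟩ | ⟨E, hE, rfl⟩)
      · exact hE.withArc huv h
      · rw [edge_comm]; exact hE.withArc huv.symm h'
  have hdisj : Disjoint ((orientations G).image (fun D => addArc D u v))
      ((orientations G).image (fun D => addArc D v u)) := by
    rw [Finset.disjoint_left]
    simp only [Finset.mem_image, mem_orientations]
    rintro _ ⟨E, hE, rfl⟩ ⟨E', hE', heq⟩
    have h1 := (hE.withArc huv h).2 u v (Or.inr ⟨rfl, rfl⟩)
    rw [← heq] at h1
    exact h1 (Or.inr ⟨rfl, rfl⟩)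
  have hi : ∀ {a b : V}, ¬ G.Adj a b →
      Set.InjOn (fun D => addArc D a b) (orientations G : Set (V → V → Prop)) := by
    intro a b hab
    simpa [orientations] using addArc_injOn hab
  rw [hunion, Finset.sum_union hdisj, Finset.sum_image (hi h), Finset.sum_image (hi h'),
    Finset.sum_add_distrib]

open Classical in
/-- Deletion-contraction: the Whitney sum counts the acyclic orientations of a contraction. -/
theorem sum_subgraphs_eq_acyclicModulo (G B : SimpleGraph V) :
    ∑ A ∈ subgraphs G,
        (-1 : ℤ) ^ (A.edgeSet.ncard + Nat.card (B ⊔ A).ConnectedComponent) =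
      (-1) ^ Nat.card B.ConnectedComponent *
        ∑ D ∈ orientations G, if AcyclicModulo D B then 1 else 0 := by
  induction G using induction_sup_edge generalizing B with
  | bot =>
    have : orientations (⊥ : SimpleGraph V) = {fun _ _ => False} := by
      ext D
      simp only [mem_orientations, Finset.mem_singleton, IsOrientation, bot_adj]
      constructor
      · intro h
        funext x y
        simpa using fun hxy => (h.1 x y).2 (Or.inl hxy)
      · rintro rfl
        simp
    rw [this, subgraphs_bot]
    simp [AcyclicModulo]
  | sup_edge G u v huv h ih =>
    rw [sum_subgraphs_sup_edge G huv h, sum_orientations_sup_edge G huv h]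
    have hterm : ∀ A ∈ subgraphs G, (A ⊔ edge u v).edgeSet.ncard = A.edgeSet.ncard + 1 :=
      fun A hA => edgeSet_ncard_sup_edge A huv fun hA' => h (mem_subgraphs.1 hA hA')
    -- If `B` already identifies `u` and `v`, the new edge is a loop of the contraction: adding it
    -- to `A` only flips the sign, and neither direction is acyclic, so both sides vanish.
    by_cases hr : B.Reachable u v
    · rw [Finset.sum_eq_zero, Finset.sum_eq_zero, mul_zero]
      · intro D _
        rw [if_neg, if_neg, add_zero]
        · exact fun hD => (acyclicModulo_addArc.1 hD).2 (reflTransGen_of_reachable hr)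
        · exact fun hD => (acyclicModulo_addArc.1 hD).2 (reflTransGen_of_reachable hr.symm)
      · intro A hA
        rw [hterm A hA, ← sup_assoc,
          card_connectedComponent_sup_edge_of_reachable _ (hr.mono le_sup_left)]
        ring
    -- The subgraphs that contain the edge are counted by contracting it, that is, by moving it into
    -- `B`; the minus sign is the edge itself.
    · have h1 : ∑ A ∈ subgraphs G, ((-1 : ℤ) ^ (A.edgeSet.ncard +
            Nat.card (B ⊔ A).ConnectedComponent) + (-1) ^ ((A ⊔ edge u v).edgeSet.ncard +
            Nat.card (B ⊔ (A ⊔ edge u v)).ConnectedComponent)) =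
          ∑ A ∈ subgraphs G, (-1 : ℤ) ^ (A.edgeSet.ncard +
            Nat.card (B ⊔ A).ConnectedComponent) -
          ∑ A ∈ subgraphs G, (-1 : ℤ) ^ (A.edgeSet.ncard +
            Nat.card (B ⊔ edge u v ⊔ A).ConnectedComponent) := by
        rw [← Finset.sum_sub_distrib]
        refine Finset.sum_congr rfl fun A hA => ?_
        rw [hterm A hA, sup_right_comm, ← sup_assoc]
        ring
      rw [h1, ih, ih, ← card_connectedComponent_sup_edge_of_not_reachable B hr, pow_succ]
      -- An acyclic `D` extends in at least one direction, as mixed walks both ways between `u` and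
      -- `v` would give a cycle. It extends in both exactly when it stays acyclic after contracting
      -- the edge.
      have h2 : ∑ D ∈ orientations G, ((if AcyclicModulo (addArc D u v) B then (1 : ℤ) else 0) +
            if AcyclicModulo (addArc D v u) B then 1 else 0) =
          (∑ D ∈ orientations G, if AcyclicModulo D B then (1 : ℤ) else 0) +
            ∑ D ∈ orientations G, if AcyclicModulo D (B ⊔ edge u v) then (1 : ℤ) else 0 := by
        rw [← Finset.sum_add_distrib]
        refine Finset.sum_congr rfl fun D _ => ?_
        simp only [acyclicModulo_addArc, acyclicModulo_sup_edge hr]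
        by_cases hD : AcyclicModulo D B
        · have h3 := hD.not_reflTransGen_both hr
          by_cases h4 : Relation.ReflTransGen (mixedStep D B) u v
          · simp [hD, h4, h3 h4]
          · simp [hD, h4, add_comm]
        · simp [hD]
      rw [h2]
      ring

/-- Stanley's theorem: the Tutte polynomial at `(2, 0)` counts the acyclic orientations. -/
theorem numAcyclicOrientations_eq (G : SimpleGraph V) :
    (numAcyclicOrientations G : ℤ) = at20 (tuttePolynomial G) := by
  classical
  have h1 : numAcyclicOrientations G =
      ((orientations G).filter fun D => AcyclicModulo D ⊥).card := by
    rw [numAcyclicOrientations, ← Set.ncard_coe_finset]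
    congr 1
    ext D
    simp [acyclicModulo_bot]
  have h2 := sum_subgraphs_eq_acyclicModulo G ⊥
  have h3 : Nat.card (⊥ : SimpleGraph V).ConnectedComponent = Fintype.card V := by
    simpa [graphNullity] using (graphNullity_add_card (⊥ : SimpleGraph V)).symm
  rw [tuttePolynomial, at20_partialTutte]
  simp only [if_true, nullitySign_eq, ← Finset.mul_sum]
  simp only [bot_sup_eq] at h2
  rw [h2, h1, h3, ← mul_assoc, ← mul_pow]
  simp

end AcyclicOrientations

/-! ### Disjoint copies and multiplicativity of the sign. -/

section DisjointUnion

variable {ι V : Type}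

/-- The disjoint union of the graphs `F i`. -/
def disjointUnion (F : ι → SimpleGraph V) : SimpleGraph (ι × V) where
  Adj x y := x.1 = y.1 ∧ (F x.1).Adj x.2 y.2
  symm := ⟨by
    rintro ⟨i, u⟩ ⟨j, v⟩ ⟨h, h'⟩
    obtain rfl : i = j := h
    exact ⟨rfl, h'.symm⟩⟩
  loopless := ⟨fun _ h => h.2.ne rfl⟩

theorem disjointUnion_adj {F : ι → SimpleGraph V} {x y : ι × V} :
    (disjointUnion F).Adj x y ↔ x.1 = y.1 ∧ (F x.1).Adj x.2 y.2 := Iff.rfl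

theorem disjointUnion_reachable {F : ι → SimpleGraph V} {x y : ι × V} :
    (disjointUnion F).Reachable x y ↔ x.1 = y.1 ∧ (F x.1).Reachable x.2 y.2 := by
  constructor
  · rintro ⟨p⟩
    induction p with
    | nil => exact ⟨rfl, Reachable.refl _⟩
    | cons h _ ih =>
      obtain ⟨h1, h2⟩ := h
      obtain ⟨h3, h4⟩ := ih
      exact ⟨h1.trans h3, h2.reachable.trans (h1 ▸ h4)⟩
  · obtain ⟨i, u⟩ := x
    obtain ⟨j, v⟩ := y
    rintro ⟨h, ⟨p⟩⟩
    obtain rfl : i = j := h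
    let f : F i →g disjointUnion F := ⟨fun w => (i, w), fun h => ⟨rfl, h⟩⟩
    exact ⟨p.map f⟩

theorem disjointUnion_injective :
    Function.Injective (disjointUnion : (ι → SimpleGraph V) → SimpleGraph (ι × V)) := by
  intro F F' h
  funext i
  ext u v
  have : (disjointUnion F).Adj (i, u) (i, v) ↔ (disjointUnion F').Adj (i, u) (i, v) := by rw [h]
  simpa [disjointUnion_adj] using this

theorem disjointUnion_update [DecidableEq ι] (F : ι → SimpleGraph V) (i : ι) (u v : V) :
    disjointUnion (Function.update F i (F i ⊔ edge u v)) =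
      disjointUnion F ⊔ edge (i, u) (i, v) := by
  ext ⟨j, x⟩ ⟨k, y⟩
  simp only [disjointUnion_adj, sup_adj, edge_adj, Prod.mk.injEq, ne_eq]
  by_cases hj : j = i
  · subst hj
    simp only [Function.update_self, sup_adj, edge_adj]
    by_cases hk : j = k
    · subst hk; simp
    · have : k ≠ j := Ne.symm hk
      simp [hk, this]
  · rw [Function.update_of_ne hj]
    simp [hj]

variable [Fintype ι] [Fintype V]

-- Removing an edge from one copy changes both sides by the same factor, because reachability inside
-- a copy is not affected by the others.
open Classical in
theorem nullitySign_disjointUnion (F : ι → SimpleGraph V) :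
    nullitySign (disjointUnion F) = ∏ i, nullitySign (F i) := by
  induction F using WellFoundedLT.induction with | _ F ih =>
  by_cases hF : F = ⊥
  · subst hF
    have : disjointUnion (⊥ : ι → SimpleGraph V) = ⊥ := by
      ext; simp [disjointUnion_adj]
    simp [this, nullitySign_bot]
  · obtain ⟨i, hi⟩ := Function.ne_iff.1 hF
    obtain ⟨u, v, huv⟩ := ne_bot_iff_exists_adj.1 hi
    set E := Function.update F i (F i \ edge u v) with hE
    have hEi : E i = F i \ edge u v := by simp [hE]
    have hn : ¬ (E i).Adj u v := by simp [hEi, sdiff_adj, edge_adj, huv.ne]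
    have hFE : F = Function.update E i (E i ⊔ edge u v) := by
      rw [hEi, sdiff_sup_self, sup_eq_left.2 ((edge_le_iff _).2 (Or.inr huv)), hE]
      simp
    have hlt : E < F := by
      refine lt_of_le_of_ne ?_ fun h => hn (h ▸ huv)
      exact update_le_iff.2 ⟨sdiff_le, fun _ _ => le_rfl⟩
    have hprod : ∏ j, nullitySign (F j) =
        (∏ j, nullitySign (E j)) * if (E i).Reachable u v then -1 else 1 := by
      rw [← Finset.mul_prod_erase _ _ (Finset.mem_univ i),
        ← Finset.mul_prod_erase _ (fun j => nullitySign (E j)) (Finset.mem_univ i)]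
      have h1 : ∏ j ∈ Finset.univ.erase i, nullitySign (F j) =
          ∏ j ∈ Finset.univ.erase i, nullitySign (E j) :=
        Finset.prod_congr rfl fun j hj => by
          rw [hE, Function.update_of_ne (Finset.ne_of_mem_erase hj)]
      have h2 : F i = E i ⊔ edge u v := by
        conv_lhs => rw [hFE]
        simp
      rw [h1, h2, nullitySign_sup_edge _ huv.ne hn]
      ring
    rw [hprod, ← ih E hlt]
    conv_lhs => rw [hFE]
    rw [disjointUnion_update, nullitySign_sup_edge]
    · simp [disjointUnion_reachable]
    · simpa using huv.ne
    · simpa [disjointUnion_adj] using hn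

theorem sum_subgraphs_disjointUnion [DecidableEq ι] {M : Type*} [AddCommMonoid M] (G : SimpleGraph V)
    (f : SimpleGraph (ι × V) → M) :
    ∑ A ∈ subgraphs (disjointUnion fun _ : ι => G), f A =
      ∑ F ∈ Fintype.piFinset fun _ : ι => subgraphs G, f (disjointUnion F) := by
  classical
  have : subgraphs (disjointUnion fun _ : ι => G) =
      (Fintype.piFinset fun _ : ι => subgraphs G).image disjointUnion := by
    ext A
    simp only [mem_subgraphs, Finset.mem_image, Fintype.mem_piFinset]
    constructor
    · intro hA
      refine ⟨fun i => A.comap fun v => (i, v), fun i u v h => (hA h).2, ?_⟩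
      ext ⟨i, u⟩ ⟨j, v⟩
      constructor
      · rintro ⟨h, h'⟩
        obtain rfl : i = j := h
        exact h'
      · intro h
        obtain rfl : i = j := (hA h).1
        exact ⟨rfl, h⟩
    · rintro ⟨F, hF, rfl⟩ x y ⟨h, h'⟩
      exact ⟨h, hF _ h'⟩
  rw [this, Finset.sum_image disjointUnion_injective.injOn]

end DisjointUnion

/-! ### Transfer of corner partitions through the gluing. -/

section Transfer

variable {ι V : Type}

open Classical in
/-- The connection pattern of the marked vertices `p i` in `A`. -/
noncomputable def connectionPattern (A : SimpleGraph V) (p : ι → V) (i j : ι) : Bool :=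
  decide (A.Reachable (p i) (p j))

/-- The connection pattern after joining the classes of `a` and `b`. -/
def joinPattern (ρ : ι → ι → Bool) (a b x y : ι) : Bool :=
  ρ x y || (ρ x a && ρ b y) || (ρ x b && ρ a y)

/-- The effect on a weight `g` of a connection pattern of an optional edge from `a` to `b`. -/
def withBridge (a b : ι) (g : (ι → ι → Bool) → ℤ) (ρ : ι → ι → Bool) : ℤ :=
  g ρ + (if ρ a b then -1 else 1) * g (joinPattern ρ a b)

theorem connectionPattern_sup_edge (A : SimpleGraph V) (p : ι → V) (a b : ι) :
    connectionPattern (A ⊔ edge (p a) (p b)) p = joinPattern (connectionPattern A p) a b := by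
  funext x y
  rw [Bool.eq_iff_iff]
  simp [connectionPattern, joinPattern, reachable_sup_edge_iff, or_assoc]

/-- Both the sign change and the new pattern are functions of the old pattern, so an edge between
marked vertices can be traded for an operator on weights. -/
theorem sum_subgraphs_withBridge [Fintype V] (G : SimpleGraph V) (p : ι → V) {a b : ι}
    (hab : p a ≠ p b) (h : ¬ G.Adj (p a) (p b)) (g : (ι → ι → Bool) → ℤ) :
    ∑ A ∈ subgraphs (G ⊔ edge (p a) (p b)), nullitySign A * g (connectionPattern A p) =
      ∑ A ∈ subgraphs G, nullitySign A * withBridge a b g (connectionPattern A p) := by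
  rw [sum_subgraphs_sup_edge G hab h]
  refine Finset.sum_congr rfl fun A hA => ?_
  rw [nullitySign_sup_edge A hab fun h' => h (mem_subgraphs.1 hA h'), connectionPattern_sup_edge,
    withBridge]
  by_cases hr : A.Reachable (p a) (p b) <;> simp [connectionPattern, hr] <;> ring

/-- The five partitions of three points: `0` is the partition with one class, `4` the one with
three classes, and `k + 1` separates `k` from the two other points. -/
def statePattern (t : Fin 5) (i j : Fin 3) : Bool :=
  t = 0 || i = j || (t != 4 && i.val + 1 != t.val && j.val + 1 != t.val)

theorem statePattern_injective : Function.Injective statePattern := by decide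

theorem exists_connectionPattern_eq (A : SimpleGraph V) (q : Fin 3 → V) :
    ∃ t, connectionPattern A q = statePattern t := by
  -- Of the eight combinations of pairwise connections, transitivity excludes the three with exactly
  -- two; the other five are the states.
  have hr : ∀ i, A.Reachable (q i) (q i) := fun _ => Reachable.refl _
  have hc : ∀ i j, A.Reachable (q i) (q j) ↔ A.Reachable (q j) (q i) := fun _ _ => reachable_comm
  have ht : ∀ i j k, A.Reachable (q i) (q j) → A.Reachable (q j) (q k) →
      A.Reachable (q i) (q k) := fun _ _ _ => Reachable.trans
  have t1 := ht 0 1 2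
  have t2 := ht 1 0 2
  have t3 := ht 0 2 1
  rw [hc 1 0] at t2
  rw [hc 2 1] at t3
  suffices ∃ t, ∀ i j, connectionPattern A q i j = statePattern t i j from
    this.imp fun t h => funext fun i => funext fun j => h i j
  by_cases h1 : A.Reachable (q 0) (q 1) <;> by_cases h2 : A.Reachable (q 0) (q 2) <;>
    by_cases h3 : A.Reachable (q 1) (q 2)
  · refine ⟨0, ?_⟩
    simp [Fin.forall_fin_succ, connectionPattern, statePattern, hc 1 0, hc 2 0, hc 2 1, *]
  · tauto
  · tauto
  · refine ⟨3, ?_⟩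
    simp [Fin.forall_fin_succ, connectionPattern, statePattern, hc 1 0, hc 2 0, hc 2 1, *]
  · tauto
  · refine ⟨2, ?_⟩
    simp [Fin.forall_fin_succ, connectionPattern, statePattern, hc 1 0, hc 2 0, hc 2 1, *]
  · refine ⟨1, ?_⟩
    simp [Fin.forall_fin_succ, connectionPattern, statePattern, hc 1 0, hc 2 0, hc 2 1, *]
  · refine ⟨4, ?_⟩
    simp [Fin.forall_fin_succ, connectionPattern, statePattern, hc 1 0, hc 2 0, hc 2 1, *]

/-- The signed number of spanning subgraphs of `G` that connect the points `q i` as in the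
state `t`. -/
noncomputable def stateSum [Fintype V] (G : SimpleGraph V) (q : Fin 3 → V) (t : Fin 5) : ℤ :=
  ∑ A ∈ subgraphs G, if connectionPattern A q = statePattern t then nullitySign A else 0

/-- The connection pattern of the nine corners of three disjoint copies. -/
def triplePattern (t : Fin 3 → Fin 5) (x y : Fin 3 × Fin 3) : Bool :=
  x.1 = y.1 && statePattern (t x.1) x.2 y.2

/-- The graph that consists of three copies of `G`, joined in pairs by an edge between two
corresponding corners. -/
def gluedGraph (G : SimpleGraph V) (q : Fin 3 → V) : SimpleGraph (Fin 3 × V) :=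
  disjointUnion (fun _ => G) ⊔ edge (0, q 2) (1, q 2) ⊔ edge (0, q 1) (2, q 1) ⊔
    edge (1, q 0) (2, q 0)

/-- The indicator of the state `s` at the three outer corners. -/
def cornerIndicator (s : Fin 5) (ρ : Fin 3 × Fin 3 → Fin 3 × Fin 3 → Bool) : ℤ :=
  if (fun i j => ρ (i, i) (j, j)) = statePattern s then 1 else 0

/-- The coefficient of the transfer of the states `t` of three copies into the state `s`. -/
def glueCoeff (s : Fin 5) (t : Fin 3 → Fin 5) : ℤ :=
  withBridge (0, 2) (1, 2) (withBridge (0, 1) (2, 1) (withBridge (1, 0) (2, 0)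
    (cornerIndicator s))) (triplePattern t)

theorem connectionPattern_disjointUnion (F : Fin 3 → SimpleGraph V) (q : Fin 3 → V)
    (t : Fin 3 → Fin 5) (h : ∀ i, connectionPattern (F i) q = statePattern (t i)) :
    connectionPattern (disjointUnion F) (fun x : Fin 3 × Fin 3 => (x.1, q x.2)) =
      triplePattern t := by
  funext x y
  rw [triplePattern, ← h, Bool.eq_iff_iff]
  simp [connectionPattern, disjointUnion_reachable]

variable [Fintype V]

/-- The three joining edges are peeled off, the last one becoming the innermost `withBridge`. What
remains runs over triples of subgraphs of `G`, which are grouped by their states. -/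
theorem stateSum_gluedGraph (G : SimpleGraph V) (q : Fin 3 → V) (s : Fin 5) :
    stateSum (gluedGraph G q) (fun i => (i, q i)) s =
      ∑ t : Fin 3 → Fin 5, glueCoeff s t * ∏ i, stateSum G q (t i) := by
  classical
  set p : Fin 3 × Fin 3 → Fin 3 × V := fun x => (x.1, q x.2) with hp
  have h1 : stateSum (gluedGraph G q) (fun i => (i, q i)) s =
      ∑ A ∈ subgraphs (gluedGraph G q),
        nullitySign A * cornerIndicator s (connectionPattern A p) := by
    refine Finset.sum_congr rfl fun A _ => ?_
    simp only [cornerIndicator, mul_ite, mul_one, mul_zero]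
    rfl
  have h2 : gluedGraph G q = disjointUnion (fun _ => G) ⊔ edge (p (0, 2)) (p (1, 2)) ⊔
    edge (p (0, 1)) (p (2, 1)) ⊔ edge (p (1, 0)) (p (2, 0)) := rfl
  rw [h1, h2, sum_subgraphs_withBridge, sum_subgraphs_withBridge, sum_subgraphs_withBridge,
    sum_subgraphs_disjointUnion]
  -- For fixed `F` only the triple of its actual states contributes; introducing the full sum over
  -- `t` lets the sum over `F` factor copy by copy.
  · have h3 : ∀ F : Fin 3 → SimpleGraph V, nullitySign (disjointUnion F) *
        withBridge (0, 2) (1, 2) (withBridge (0, 1) (2, 1) (withBridge (1, 0) (2, 0)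
          (cornerIndicator s))) (connectionPattern (disjointUnion F) p) =
        ∑ t : Fin 3 → Fin 5, glueCoeff s t *
          ∏ i, if connectionPattern (F i) q = statePattern (t i) then nullitySign (F i) else 0 := by
      intro F
      choose t ht using fun i => exists_connectionPattern_eq (F i) q
      rw [Finset.sum_eq_single t, connectionPattern_disjointUnion F q t ht,
        nullitySign_disjointUnion, glueCoeff, mul_comm]
      · simp [ht]
      · intro t' _ hne
        obtain ⟨i, hi⟩ := Function.ne_iff.1 hne
        rw [Finset.prod_eq_zero (Finset.mem_univ i), mul_zero]
        rw [if_neg]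
        rw [ht i]
        exact fun h => hi (statePattern_injective h).symm
      · simp
    simp only [h3]
    rw [Finset.sum_comm]
    refine Finset.sum_congr rfl fun t _ => ?_
    rw [← Finset.mul_sum]
    congr 1
    simp only [stateSum]
    rw [Finset.prod_univ_sum]
  · simp [hp]
  · simp [hp, disjointUnion_adj]
  · simp [hp]
  · simp [hp, disjointUnion_adj, edge_adj]
  · simp [hp]
  · simp [hp, disjointUnion_adj, edge_adj]

/-- The sums of `f` over the states with one, two and three classes. -/
def sumByKind (f : Fin 5 → ℤ) : Fin 3 → ℤ := ![f 0, f 1 + f 2 + f 3, f 4]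

/-- The transfer coefficients, summed over the states with given numbers of classes. -/
def kindCoeff (s : Fin 5) (i j k : Fin 3) : ℤ :=
  sumByKind (fun a => sumByKind (fun b => sumByKind (fun c => glueCoeff s ![a, b, c]) k) j) i

/-- With equal weights on the two-class states, the 125 triples of states collapse to 27 triples of
kinds. -/
theorem sum_glueCoeff_mul_prod (s : Fin 5) (W : Fin 5 → ℤ) (w : Fin 3 → ℤ)
    (hW : W = ![w 0, w 1, w 1, w 1, w 2]) :
    ∑ t : Fin 3 → Fin 5, glueCoeff s t * ∏ i, W (t i) =
      ∑ i, ∑ j, ∑ k, kindCoeff s i j k * (w i * w j * w k) := by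
  have hkind : ∀ f : Fin 5 → ℤ, ∑ a, f a * W a = ∑ i, sumByKind f i * w i := by
    intro f
    subst hW
    simp [Fin.sum_univ_five, Fin.sum_univ_three, sumByKind]
    ring
  have hlin : ∀ (f : Fin 5 → Fin 3 → ℤ) (i : Fin 3),
      sumByKind (fun a => ∑ j, f a j * w j) i = ∑ j, sumByKind (fun a => f a j) i * w j := by
    intro f i
    fin_cases i <;> simp [sumByKind, Fin.sum_univ_three] ; ring
  have hexp : ∑ t : Fin 3 → Fin 5, glueCoeff s t * ∏ i, W (t i) =
      ∑ a, (∑ b, (∑ c, glueCoeff s ![a, b, c] * W c) * W b) * W a := by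
    have h0 : ∀ {m : ℕ} (F : (Fin (m + 1) → Fin 5) → ℤ),
        ∑ t, F t = ∑ a, ∑ t, F (Matrix.vecCons a t) := by
      intro m F
      rw [← (Fin.consEquiv fun _ => Fin 5).sum_comp, Fintype.sum_prod_type]
      rfl
    rw [h0]
    refine Finset.sum_congr rfl fun a _ => ?_
    rw [h0, Finset.sum_mul]
    refine Finset.sum_congr rfl fun b _ => ?_
    rw [h0, Finset.sum_mul, Finset.sum_mul]
    refine Finset.sum_congr rfl fun c _ => ?_
    rw [Fintype.sum_subsingleton _ ![], Fin.prod_univ_three]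
    simp only [Matrix.cons_val]
    ring
  rw [hexp]
  simp only [hkind, hlin]
  refine Finset.sum_congr rfl fun i _ => ?_
  rw [Finset.sum_mul]
  refine Finset.sum_congr rfl fun j _ => ?_
  rw [Finset.sum_mul, Finset.sum_mul]
  refine Finset.sum_congr rfl fun k _ => ?_
  rw [kindCoeff]
  ring

/-- The corner `(i, i)` meets no joining edge, so a copy whose corners are all separated isolates
its outer corner; hence the zeros at index `2`. The leading `2` is `3 - 1`: two of the joining
edges, or all three with the sign of the cycle. -/
theorem kindCoeff_zero : ∀ i j k, kindCoeff 0 i j k =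
    ![![![2, 4, 0], ![4, 2, 0], ![0, 0, 0]],
      ![![4, 2, 0], ![2, 0, 0], ![0, 0, 0]],
      ![![0, 0, 0], ![0, 0, 0], ![0, 0, 0]]] i j k := by
  decide +kernel

/-- Outer corner `0` is the separated one, so only the first copy may have three classes, and the
table is not symmetric in its first index. -/
theorem kindCoeff_one : ∀ i j k, kindCoeff 1 i j k =
    ![![![1, 2, 0], ![2, 4, 0], ![0, 0, 0]],
      ![![7, 12, 0], ![12, 14, 0], ![0, 0, 0]],
      ![![4, 4, 0], ![4, 4, 0], ![0, 0, 0]]] i j k := by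
  decide +kernel

theorem kindCoeff_four : ∀ i j k, kindCoeff 4 i j k =
    ![![![1, 7, 4], ![7, 40, 20], ![4, 20, 8]],
      ![![7, 40, 20], ![40, 172, 68], ![20, 68, 24]],
      ![![4, 20, 8], ![20, 68, 24], ![8, 24, 8]]] i j k := by
  decide +kernel

theorem stateSum_gluedGraph_of_symmetric (G : SimpleGraph V) (q : Fin 3 → V) {h a m : ℤ}
    (hG : stateSum G q = ![h, a, a, a, m]) :
    stateSum (gluedGraph G q) (fun i => (i, q i)) 0 = 2 * h ^ 3 + 12 * h ^ 2 * a + 6 * h * a ^ 2 ∧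
    stateSum (gluedGraph G q) (fun i => (i, q i)) 1 =
      h ^ 3 + 11 * h ^ 2 * a + 4 * h ^ 2 * m + 28 * h * a ^ 2 + 8 * h * a * m
        + 14 * a ^ 3 + 4 * a ^ 2 * m ∧
    stateSum (gluedGraph G q) (fun i => (i, q i)) 4 =
      h ^ 3 + 21 * h ^ 2 * a + 12 * h ^ 2 * m + 120 * h * a ^ 2 + 120 * h * a * m
        + 24 * h * m ^ 2 + 172 * a ^ 3 + 204 * a ^ 2 * m + 72 * a * m ^ 2 + 8 * m ^ 3 := by
  have hw : stateSum G q = ![(![h, a, m] : Fin 3 → ℤ) 0, (![h, a, m] : Fin 3 → ℤ) 1,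
    (![h, a, m] : Fin 3 → ℤ) 1, (![h, a, m] : Fin 3 → ℤ) 1, (![h, a, m] : Fin 3 → ℤ) 2] := hG
  simp only [stateSum_gluedGraph, sum_glueCoeff_mul_prod _ _ _ hw, kindCoeff_zero, kindCoeff_one,
    kindCoeff_four]
  simp only [Fin.sum_univ_three, Matrix.cons_val]
  refine ⟨?_, ?_, ?_⟩ <;> ring

end Transfer

/-! ### Invariance under isomorphism, and divisibility by powers of `x - 1`. -/

section Isomorphism

variable {V W : Type} [Fintype V] [Fintype W]

theorem graphRank_congr {A : SimpleGraph V} {B : SimpleGraph W} (φ : A ≃g B) :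
    graphRank A = graphRank B := by
  rw [graphRank, graphRank, Fintype.card_congr φ.toEquiv, Nat.card_congr φ.connectedComponentEquiv]

theorem graphNullity_congr {A : SimpleGraph V} {B : SimpleGraph W} (φ : A ≃g B) :
    graphNullity A = graphNullity B := by
  rw [graphNullity, graphNullity, graphRank_congr φ, ← Nat.card_coe_set_eq, ← Nat.card_coe_set_eq,
    Nat.card_congr φ.mapEdgeSet]

/-- The isomorphism of `A` with its transport along a bijection of the vertices. -/
def isoSimpleGraph {V W : Type} (e : V ≃ W) (A : SimpleGraph V) : A ≃g e.simpleGraph A where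
  toEquiv := e
  map_rel_iff' := by simp [Equiv.simpleGraph]

theorem reachable_simpleGraph_iff {V W : Type} (e : V ≃ W) (A : SimpleGraph V) (u v : V) :
    (e.simpleGraph A).Reachable (e u) (e v) ↔ A.Reachable u v :=
  (isoSimpleGraph e A).reachable_iff (u := u) (v := v)

theorem partialTutte_congr {G : SimpleGraph V} {G' : SimpleGraph W} (e : V ≃ W)
    (he : ∀ u v, G.Adj u v ↔ G'.Adj (e u) (e v)) {P : SimpleGraph V → Prop}
    {P' : SimpleGraph W → Prop} (hP : ∀ A, P A ↔ P' (e.simpleGraph A)) :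
    partialTutte G P = partialTutte G' P' := by
  have hG : ∀ A : SimpleGraph V, A ≤ G ↔ e.simpleGraph A ≤ G' := by
    intro A
    constructor
    · intro hA x y hxy
      have := (he _ _).1 (hA (show A.Adj (e.symm x) (e.symm y) from hxy))
      simpa using this
    · intro hA x y hxy
      exact (he _ _).2 (hA ((isoSimpleGraph e A).map_adj_iff.2 hxy))
  have φ : G ≃g G' := ⟨e, (he _ _).symm⟩
  refine Finset.sum_equiv e.simpleGraph (fun A => ?_) fun A _ => ?_
  · rw [mem_spanningSubgraphs, mem_spanningSubgraphs, hG, hP]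
  · rw [graphRank_congr φ, graphRank_congr (isoSimpleGraph e A),
      graphNullity_congr (isoSimpleGraph e A)]

theorem stateSum_eq_at20 (G : SimpleGraph V) (q : Fin 3 → V) (t : Fin 5) :
    stateSum G q t =
      at20 (partialTutte G fun A => connectionPattern A q = statePattern t) := by
  rw [at20_partialTutte, stateSum]
  refine Finset.sum_congr rfl fun A _ => ?_
  congr

theorem connectionPattern_simpleGraph {ι V W : Type} (e : V ≃ W) (A : SimpleGraph V) (q : ι → V) :
    connectionPattern (e.simpleGraph A) (fun i => e (q i)) = connectionPattern A q := by
  funext i j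
  exact decide_eq_decide.2 (reachable_simpleGraph_iff e A _ _)

theorem stateSum_congr {G : SimpleGraph V} {G' : SimpleGraph W} (e : V ≃ W)
    (he : ∀ u v, G.Adj u v ↔ G'.Adj (e u) (e v)) (q : Fin 3 → V) (t : Fin 5) :
    stateSum G q t = stateSum G' (fun i => e (q i)) t := by
  rw [stateSum_eq_at20, stateSum_eq_at20, partialTutte_congr e he]
  intro A
  rw [connectionPattern_simpleGraph]

theorem sum_stateSum (G : SimpleGraph V) (q : Fin 3 → V) :
    ∑ t, stateSum G q t = at20 (tuttePolynomial G) := by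
  classical
  rw [tuttePolynomial, at20_partialTutte]
  simp only [stateSum]
  rw [Finset.sum_comm]
  refine Finset.sum_congr rfl fun A _ => ?_
  obtain ⟨t, ht⟩ := exists_connectionPattern_eq A q
  rw [Finset.sum_eq_single t]
  · simp [ht]
  · intro s _ hs
    rw [if_neg]
    rw [ht]
    exact fun h => hs (statePattern_injective h).symm
  · simp

/-- If `G` is connected and the subgraphs with the property `P` have more than `d` components,
then the restricted Tutte sum is divisible by `(x - 1) ^ d`. -/
theorem exists_partialTutte_eq_mul {G : SimpleGraph V} (hG : G.Connected)
    {P : SimpleGraph V → Prop} {d : ℕ}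
    (hP : ∀ A, P A → d + 1 ≤ Nat.card A.ConnectedComponent) :
    ∃ N, partialTutte G P = (X 0 - 1) ^ d * N := by
  have h1 : Nat.card G.ConnectedComponent = 1 := by
    have := hG.preconnected.subsingleton_connectedComponent
    have := hG.nonempty
    exact Nat.card_eq_one_iff_unique.2 ⟨inferInstance, inferInstance⟩
  refine ⟨∑ A ∈ spanningSubgraphs G P,
    (X 0 - 1) ^ (graphRank G - graphRank A - d) * (X 1 - 1) ^ graphNullity A, ?_⟩
  rw [partialTutte, Finset.mul_sum]
  refine Finset.sum_congr rfl fun A hA => ?_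
  have h2 := hP A (mem_spanningSubgraphs.1 hA).2
  have h3 := card_connectedComponent_le A
  -- As `G` has one component, this difference of ranks is `k(A) - 1`, hence at least `d`.
  have h4 : graphRank G - graphRank A = d + (graphRank G - graphRank A - d) := by
    unfold graphRank
    omega
  rw [← mul_assoc, ← pow_add, ← h4]

theorem gluedGraph_preconnected {V : Type} {G : SimpleGraph V} (hG : G.Preconnected)
    (q : Fin 3 → V) : (gluedGraph G q).Preconnected := by
  have hle : disjointUnion (fun _ => G) ≤ gluedGraph G q :=
    le_sup_left.trans (le_sup_left.trans le_sup_left)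
  have hcopy : ∀ i u v, (gluedGraph G q).Reachable (i, u) (i, v) := fun i u v =>
    ((disjointUnion_reachable (x := (i, u)) (y := (i, v))).2 ⟨rfl, hG u v⟩).mono hle
  have h01 : (gluedGraph G q).Adj (1, q 2) (0, q 2) := by
    simp [gluedGraph, edge_adj]
  have h02 : (gluedGraph G q).Adj (2, q 1) (0, q 1) := by
    simp [gluedGraph, edge_adj]
  have hbase : ∀ x, (gluedGraph G q).Reachable x (0, q 0) := by
    rintro ⟨i, u⟩
    fin_cases i
    · exact hcopy 0 _ _
    · exact (hcopy 1 _ _).trans (h01.reachable.trans (hcopy 0 _ _))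
    · exact (hcopy 2 _ _).trans (h02.reachable.trans (hcopy 0 _ _))
  exact fun x y => (hbase x).trans (hbase y).symm

end Isomorphism

/-! ### Symmetry and self-similarity of the Schreier graphs. -/

section Words

/-- Only the first occurrence of `i` or `j` is changed, so the last letter is affected only if
neither occurs before it. -/
theorem hanoiSwap_append_singleton (i j : Fin 3) (w : List (Fin 3)) (x : Fin 3) :
    hanoiSwap i j (w ++ [x]) =
      if i ∈ w ∨ j ∈ w then hanoiSwap i j w ++ [x] else w ++ hanoiSwap i j [x] := by
  induction w with
  | nil => simp
  | cons y w ih =>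
    by_cases h1 : y = i
    · simp [hanoiSwap, h1]
    · by_cases h2 : y = j
      · subst h2; simp [hanoiSwap, h1]
      · have h3 : i ≠ y := Ne.symm h1
        have h4 : j ≠ y := Ne.symm h2
        simp only [List.cons_append, hanoiSwap, h1, h2, if_false, ih, List.mem_cons, h3, h4,
          false_or]
        split_ifs <;> rfl

theorem hanoiSwap_eq_self {i j : Fin 3} {w : List (Fin 3)} (h : ¬ (i ∈ w ∨ j ∈ w)) :
    hanoiSwap i j w = w := by
  induction w with
  | nil => rfl
  | cons y w ih =>
    simp only [List.mem_cons, not_or] at h ih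
    obtain ⟨⟨h1, h2⟩, h3, h4⟩ := h
    simp [hanoiSwap, Ne.symm h1, Ne.symm h3, ih ⟨h2, h4⟩]

theorem hanoiSwap_comm {i j : Fin 3} (hij : i ≠ j) : hanoiSwap i j = hanoiSwap j i := by
  funext w
  induction w with
  | nil => rfl
  | cons y w ih =>
    by_cases h1 : y = i
    · subst h1; simp [hanoiSwap, hij]
    · by_cases h2 : y = j <;> simp [hanoiSwap, h1, h2, ih]

theorem hanoiSwap_map (σ : Equiv.Perm (Fin 3)) (i j : Fin 3) (w : List (Fin 3)) :
    hanoiSwap (σ i) (σ j) (w.map σ) = (hanoiSwap i j w).map σ := by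
  induction w with
  | nil => rfl
  | cons y w ih =>
    by_cases h1 : y = i
    · simp [hanoiSwap, h1]
    · by_cases h2 : y = j
      · subst h2; simp [hanoiSwap, h1]
      · simp [hanoiSwap, h1, h2, ih]

theorem hanoiSchreier_adj_iff {n : ℕ} {u v : List.Vector (Fin 3) n} :
    (hanoiSchreier n).Adj u v ↔
      u ≠ v ∧ ∃ i j, i ≠ j ∧ hanoiSwap i j u.toList = v.toList := by
  refine and_congr_right fun _ => ?_
  constructor
  · rintro (h | h | h)
    exacts [⟨0, 1, by decide, h⟩, ⟨0, 2, by decide, h⟩, ⟨1, 2, by decide, h⟩]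
  · rintro ⟨i, j, hij, h⟩
    have h' := h
    rw [hanoiSwap_comm hij] at h'
    unfold hanoiA hanoiB hanoiC
    fin_cases i <;> fin_cases j <;> first | exact absurd rfl hij | tauto

/-- The bijection of the words of length `n` that permutes the letters. -/
def wordEquiv (n : ℕ) (σ : Equiv.Perm (Fin 3)) : List.Vector (Fin 3) n ≃ List.Vector (Fin 3) n where
  toFun := List.Vector.map σ
  invFun := List.Vector.map σ.symm
  left_inv v := by ext; simp
  right_inv v := by ext; simp

theorem wordEquiv_outmost (n : ℕ) (σ : Equiv.Perm (Fin 3)) (i : Fin 3) :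
    wordEquiv n σ (outmost n i) = outmost n (σ i) := by
  ext; simp [wordEquiv, outmost]

theorem hanoiSchreier_adj_wordEquiv {n : ℕ} (σ : Equiv.Perm (Fin 3))
    (u v : List.Vector (Fin 3) n) :
    (hanoiSchreier n).Adj u v ↔ (hanoiSchreier n).Adj (wordEquiv n σ u) (wordEquiv n σ v) := by
  have hto : ∀ w : List.Vector (Fin 3) n, (wordEquiv n σ w).toList = w.toList.map σ :=
    fun w => List.Vector.toList_map w σ
  have hinj : Function.Injective (List.map σ) := List.map_injective_iff.2 σ.injective
  simp only [hanoiSchreier_adj_iff, ne_eq, EmbeddingLike.apply_eq_iff_eq, hto]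
  refine and_congr_right fun _ => ?_
  constructor
  · rintro ⟨i, j, hij, h⟩
    exact ⟨σ i, σ j, by simpa using hij, by rw [hanoiSwap_map, h]⟩
  · rintro ⟨i, j, hij, h⟩
    refine ⟨σ.symm i, σ.symm j, by simpa using hij, hinj ?_⟩
    rw [← hanoiSwap_map]
    simpa using h

theorem typeOne_wordEquiv {n : ℕ} (σ : Equiv.Perm (Fin 3)) (k : Fin 3)
    (A : SimpleGraph (List.Vector (Fin 3) n)) :
    TypeOne n k A ↔ TypeOne n (σ k) ((wordEquiv n σ).simpleGraph A) := by
  have hr : ∀ i j, ((wordEquiv n σ).simpleGraph A).Reachable (outmost n (σ i)) (outmost n (σ j)) ↔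
      A.Reachable (outmost n i) (outmost n j) := by
    intro i j
    rw [← wordEquiv_outmost, ← wordEquiv_outmost]
    exact reachable_simpleGraph_iff _ _ _ _
  unfold TypeOne
  refine and_congr ?_ ?_
  · refine Iff.trans (forall_congr' fun i => ?_) σ.forall_congr_right
    refine Iff.trans (forall_congr' fun j => ?_) σ.forall_congr_right
    simp only [hr, ne_eq, EmbeddingLike.apply_eq_iff_eq]
  · refine Iff.trans (forall_congr' fun i => ?_) σ.forall_congr_right
    simp only [hr, ne_eq, EmbeddingLike.apply_eq_iff_eq]

/-- Exchanging the letters `0` and `k` is an automorphism of the graph that exchanges the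
corresponding outmost vertices. -/
theorem hanoiH1_eq (n : ℕ) (k : Fin 3) : hanoiH1 n k = hanoiH1 n 0 := by
  refine (partialTutte_congr (wordEquiv n (Equiv.swap 0 k)) (hanoiSchreier_adj_wordEquiv _)
    fun A => ?_).symm
  simpa using typeOne_wordEquiv (Equiv.swap 0 k) 0 A

theorem toList_snoc {α : Type} {n : ℕ} (w : List.Vector α n) (x : α) :
    (w.snoc x).toList = w.toList ++ [x] := by
  simp [List.Vector.snoc]

/-- Words of length `n + 1` are pairs of a last letter and a word of length `n`. -/
noncomputable def snocEquiv (n : ℕ) : Fin 3 × List.Vector (Fin 3) n ≃ List.Vector (Fin 3) (n + 1) :=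
  Equiv.ofBijective (fun x => x.2.snoc x.1) (by
    constructor
    · rintro ⟨i, u⟩ ⟨j, v⟩ h
      have h' := congrArg List.Vector.toList h
      simp only [toList_snoc] at h'
      obtain ⟨h1, h2⟩ := List.append_inj' h' rfl
      exact Prod.ext (by simpa using h2) (List.Vector.eq _ _ h1)
    · intro v
      -- The motive ranges over all lengths `m` with `m = n + 1`, so that splitting off the last
      -- letter is not blocked by the fixed index.
      exact List.Vector.revCasesOn (C := fun {m} (w : List.Vector (Fin 3) m) => ∀ h : m = n + 1,
        ∃ x : Fin 3 × List.Vector (Fin 3) n, x.2.snoc x.1 = h ▸ w) v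
        (fun h => absurd h (by omega))
        (fun w x h => by obtain rfl := Nat.succ.inj h; exact ⟨(x, w), rfl⟩) rfl)

theorem snocEquiv_apply {n : ℕ} (i : Fin 3) (w : List.Vector (Fin 3) n) :
    snocEquiv n (i, w) = w.snoc i := rfl

/-- A generator either moves the prefix and keeps the last letter, or the prefix avoids `i` and `j`,
hence is `k^n`, and the last letter is exchanged. The second case gives the joining edge. -/
theorem snoc_eq_hanoiSwap_iff {n : ℕ} {i j k : Fin 3} (hij : i ≠ j) (hik : i ≠ k) (hjk : j ≠ k)
    (u v : List.Vector (Fin 3) n) (x y : Fin 3) :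
    (u.snoc x ≠ v.snoc y ∧ hanoiSwap i j (u.snoc x).toList = (v.snoc y).toList) ↔
      (x = y ∧ u ≠ v ∧ hanoiSwap i j u.toList = v.toList) ∨
        (u = outmost n k ∧ v = outmost n k ∧ ((x = i ∧ y = j) ∨ (x = j ∧ y = i))) := by
  have hsnoc : u.snoc x = v.snoc y ↔ x = y ∧ u = v := by
    rw [← snocEquiv_apply, ← snocEquiv_apply, EmbeddingLike.apply_eq_iff_eq, Prod.mk.injEq]
  have hout : ∀ w : List.Vector (Fin 3) n, w = outmost n k ↔ ∀ z ∈ w.toList, z = k := by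
    intro w
    constructor
    · rintro rfl z hz
      exact List.eq_of_mem_replicate hz
    · intro h
      apply List.Vector.eq
      exact List.eq_replicate_iff.2 ⟨w.toList_length, h⟩
  have hap : ∀ (a b : List (Fin 3)) (c d : Fin 3), a ++ [c] = b ++ [d] ↔ a = b ∧ c = d := by
    intro a b c d
    simp
  rw [ne_eq, hsnoc, toList_snoc, toList_snoc, hanoiSwap_append_singleton]
  by_cases h : i ∈ u.toList ∨ j ∈ u.toList
  · have hu : u ≠ outmost n k := by
      rw [ne_eq, hout]
      intro h'
      rcases h with h | h
      · exact hik (h' _ h)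
      · exact hjk (h' _ h)
    rw [if_pos h, hap]
    tauto
  · have hu : u = outmost n k := by
      rw [hout]
      intro z hz
      have h1 : z ≠ i := by rintro rfl; exact h (Or.inl hz)
      have h2 : z ≠ j := by rintro rfl; exact h (Or.inr hz)
      omega
    have hx : hanoiSwap i j [x] = [if x = i then j else if x = j then i else x] := by
      simp only [hanoiSwap]
      split_ifs <;> rfl
    rw [if_neg h, hx, hap, hanoiSwap_eq_self h]
    have huv : u.toList = v.toList ↔ u = v := ⟨List.Vector.eq _ _, congrArg _⟩
    rw [huv]
    by_cases hv : u = v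
    · subst hv
      simp only [hu, and_true, true_and, ne_eq, not_true, and_false, false_or]
      by_cases h1 : x = i
      · subst h1
        simp only [if_true, hij, true_and, false_and, or_false]
        constructor
        · rintro ⟨-, h2⟩; exact h2.symm
        · rintro rfl; exact ⟨hij, rfl⟩
      · by_cases h2 : x = j
        · subst h2
          simp only [h1, if_true, if_false, true_and, false_and, false_or]
          constructor
          · rintro ⟨-, h2⟩; exact h2.symm
          · rintro rfl; exact ⟨h1, rfl⟩
        · simp [h1, h2]
    · have : v ≠ outmost n k := fun h' => hv (hu.trans h'.symm)
      tauto

theorem gluedGraph_adj_iff {n : ℕ} (x y : Fin 3 × List.Vector (Fin 3) n) :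
    (gluedGraph (hanoiSchreier n) (outmost n)).Adj x y ↔
      (hanoiSchreier (n + 1)).Adj (snocEquiv n x) (snocEquiv n y) := by
  obtain ⟨i, u⟩ := x
  obtain ⟨j, v⟩ := y
  have hadj : ∀ {m : ℕ} {a b : List.Vector (Fin 3) m}, (hanoiSchreier m).Adj a b ↔
      (a ≠ b ∧ hanoiSwap 0 1 a.toList = b.toList) ∨ (a ≠ b ∧ hanoiSwap 0 2 a.toList = b.toList) ∨
        (a ≠ b ∧ hanoiSwap 1 2 a.toList = b.toList) := by
    intro m a b
    rw [← and_or_left, ← and_or_left]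
    rfl
  have hprop : ∀ p a b c e f g : Prop, (((p ∧ (a ∨ b ∨ c)) ∨ e) ∨ f) ∨ g ↔
      ((p ∧ a) ∨ e) ∨ ((p ∧ b) ∨ f) ∨ ((p ∧ c) ∨ g) := by
    intros; tauto
  have hedge : ∀ {a b c : Fin 3}, a ≠ b →
      ((edge (a, outmost n c) (b, outmost n c)).Adj (i, u) (j, v) ↔
        (u = outmost n c ∧ v = outmost n c ∧ ((i = a ∧ j = b) ∨ (i = b ∧ j = a)))) := by
    intro a b c hab
    simp only [edge_adj, Prod.mk.injEq, ne_eq]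
    constructor
    · tauto
    · rintro ⟨rfl, rfl, ⟨rfl, rfl⟩ | ⟨rfl, rfl⟩⟩
      · simp [hab]
      · simp [hab.symm]
  have hA := snoc_eq_hanoiSwap_iff (i := 0) (j := 1) (k := 2) (by decide) (by decide) (by decide)
    u v i j
  have hB := snoc_eq_hanoiSwap_iff (i := 0) (j := 2) (k := 1) (by decide) (by decide) (by decide)
    u v i j
  have hC := snoc_eq_hanoiSwap_iff (i := 1) (j := 2) (k := 0) (by decide) (by decide) (by decide)
    u v i j
  rw [snocEquiv_apply, snocEquiv_apply, hadj, hA, hB, hC]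
  simp only [gluedGraph, sup_adj, disjointUnion_adj, hadj, hedge (show (0 : Fin 3) ≠ 1 by decide),
    hedge (show (0 : Fin 3) ≠ 2 by decide), hedge (show (1 : Fin 3) ≠ 2 by decide)]
  exact hprop _ _ _ _ _ _ _

theorem snocEquiv_outmost (n : ℕ) (i : Fin 3) :
    snocEquiv n (i, outmost n i) = outmost (n + 1) i :=
  (List.Vector.replicate_succ_to_snoc i).symm

theorem hanoiSchreier_connected (n : ℕ) : (hanoiSchreier n).Connected := by
  have : Nonempty (List.Vector (Fin 3) n) := ⟨outmost n 0⟩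
  refine ⟨?_⟩
  induction n with
  | zero => exact fun u v => (Subsingleton.elim u v) ▸ Reachable.refl _
  | succ n ih =>
    have φ : gluedGraph (hanoiSchreier n) (outmost n) ≃g hanoiSchreier (n + 1) :=
      ⟨snocEquiv n, (gluedGraph_adj_iff _ _).symm⟩
    exact φ.preconnected_iff.1 (gluedGraph_preconnected (ih ⟨outmost n 0⟩) _)

theorem stateSum_hanoiSchreier_succ (n : ℕ) (s : Fin 5) :
    stateSum (hanoiSchreier (n + 1)) (outmost (n + 1)) s =
      stateSum (gluedGraph (hanoiSchreier n) (outmost n)) (fun i => (i, outmost n i)) s := by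
  rw [stateSum_congr (snocEquiv n) gluedGraph_adj_iff]
  simp only [snocEquiv_outmost]

theorem typeTwo_iff {n : ℕ} {A : SimpleGraph (List.Vector (Fin 3) n)} :
    TypeTwo n A ↔ connectionPattern A (outmost n) = statePattern 0 := by
  simp [TypeTwo, _root_.funext_iff, connectionPattern, statePattern]

theorem typeZero_iff {n : ℕ} {A : SimpleGraph (List.Vector (Fin 3) n)} :
    TypeZero n A ↔ connectionPattern A (outmost n) = statePattern 4 := by
  simp only [TypeZero, _root_.funext_iff, connectionPattern]
  refine forall_congr' fun i => forall_congr' fun j => ?_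
  by_cases hij : i = j
  · subst hij; simp [statePattern]
  · simp [statePattern, hij]

theorem typeOne_iff {n : ℕ} {k : Fin 3} {A : SimpleGraph (List.Vector (Fin 3) n)} :
    TypeOne n k A ↔ connectionPattern A (outmost n) = statePattern k.succ.castSucc := by
  have hs : ∀ k i j : Fin 3, statePattern k.succ.castSucc i j = decide (i = j ∨ (i ≠ k ∧ j ≠ k)) := by
    decide
  simp only [TypeOne, _root_.funext_iff, connectionPattern, hs, decide_eq_decide]
  constructor
  · rintro ⟨h1, h2⟩ i j
    by_cases hij : i = j
    · subst hij; simp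
    · by_cases hi : i = k
      · subst hi
        simp [hij, reachable_comm.not.1 (h2 j (Ne.symm hij))]
      · by_cases hj : j = k
        · subst hj; simp [hij, h2 i hij]
        · simp [hi, hj, h1 i j hi hj]
  · intro h
    exact ⟨fun i j hi hj => (h i j).2 (Or.inr ⟨hi, hj⟩), fun i hi => by simp [h, hi]⟩

theorem at20_hanoiH2 (n : ℕ) :
    at20 (hanoiH2 n) = stateSum (hanoiSchreier n) (outmost n) 0 := by
  rw [stateSum_eq_at20, hanoiH2]
  simp only [← typeTwo_iff]

theorem at20_hanoiH1 (n : ℕ) (k : Fin 3) :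
    at20 (hanoiH1 n k) = stateSum (hanoiSchreier n) (outmost n) k.succ.castSucc := by
  rw [stateSum_eq_at20, hanoiH1]
  simp only [← typeOne_iff]

theorem at20_hanoiH0 (n : ℕ) :
    at20 (hanoiH0 n) = stateSum (hanoiSchreier n) (outmost n) 4 := by
  rw [stateSum_eq_at20, hanoiH0]
  simp only [← typeZero_iff]

theorem stateSum_hanoiSchreier (n : ℕ) : stateSum (hanoiSchreier n) (outmost n) =
    ![at20 (hanoiH2 n), at20 (hanoiH1 n 0), at20 (hanoiH1 n 0), at20 (hanoiH1 n 0),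
      at20 (hanoiH0 n)] := by
  funext t
  fin_cases t
  · exact (at20_hanoiH2 n).symm
  · exact (at20_hanoiH1 n 0).symm
  · exact (at20_hanoiH1 n 1).symm.trans (by rw [hanoiH1_eq]; rfl)
  · exact (at20_hanoiH1 n 2).symm.trans (by rw [hanoiH1_eq]; rfl)
  · exact (at20_hanoiH0 n).symm

theorem at20_hanoiH (n : ℕ) :
    at20 (hanoiH n) = at20 (hanoiH2 n) + 3 * at20 (hanoiH1 n 0) + at20 (hanoiH0 n) := by
  rw [hanoiH, ← sum_stateSum _ (outmost n), stateSum_hanoiSchreier, Fin.sum_univ_five]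
  simp only [Matrix.cons_val]
  ring

/-- On the single empty word the three outmost vertices coincide, so the one-class state carries all
the weight. -/
theorem stateSum_hanoiSchreier_zero (t : Fin 5) :
    stateSum (hanoiSchreier 0) (outmost 0) t = if t = 0 then 1 else 0 := by
  have h1 : hanoiSchreier 0 = ⊥ := Subsingleton.elim _ _
  have h2 : connectionPattern (⊥ : SimpleGraph (List.Vector (Fin 3) 0)) (outmost 0) =
      statePattern 0 := by
    rw [← typeTwo_iff]
    exact fun i j => Subsingleton.elim (outmost 0 i) (outmost 0 j) ▸ Reachable.refl _
  rw [stateSum, h1, subgraphs_bot, Finset.sum_singleton, h2, nullitySign_bot]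
  simp only [statePattern_injective.eq_iff, eq_comm]

/-- Valid also for `n = 0`, which is how the initial values are obtained. -/
theorem at20_hanoi_succ (n : ℕ) {h a m : ℤ} (hh : h = at20 (hanoiH2 n))
    (ha : a = at20 (hanoiH1 n 0)) (hm : m = at20 (hanoiH0 n)) :
    at20 (hanoiH2 (n + 1)) = 2 * h ^ 3 + 12 * h ^ 2 * a + 6 * h * a ^ 2 ∧
    at20 (hanoiH1 (n + 1) 0) =
      h ^ 3 + 11 * h ^ 2 * a + 4 * h ^ 2 * m + 28 * h * a ^ 2 + 8 * h * a * m
        + 14 * a ^ 3 + 4 * a ^ 2 * m ∧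
    at20 (hanoiH0 (n + 1)) =
      h ^ 3 + 21 * h ^ 2 * a + 12 * h ^ 2 * m + 120 * h * a ^ 2 + 120 * h * a * m
        + 24 * h * m ^ 2 + 172 * a ^ 3 + 204 * a ^ 2 * m + 72 * a * m ^ 2 + 8 * m ^ 3 := by
  subst hh ha hm
  rw [at20_hanoiH2 (n + 1), at20_hanoiH1 (n + 1), at20_hanoiH0 (n + 1),
    stateSum_hanoiSchreier_succ, stateSum_hanoiSchreier_succ, stateSum_hanoiSchreier_succ]
  exact stateSum_gluedGraph_of_symmetric _ _ (stateSum_hanoiSchreier n)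

theorem two_le_card_of_typeOne {n : ℕ} {k : Fin 3} {A : SimpleGraph (List.Vector (Fin 3) n)}
    (hA : TypeOne n k A) : 1 + 1 ≤ Nat.card A.ConnectedComponent := by
  have : Nontrivial A.ConnectedComponent :=
    ⟨A.connectedComponentMk (outmost n (k + 1)), A.connectedComponentMk (outmost n k), by
      rw [ne_eq, ConnectedComponent.eq]
      exact hA.2 _ (by fin_cases k <;> decide)⟩
  exact Finite.one_lt_card

theorem three_le_card_of_typeZero {n : ℕ} {A : SimpleGraph (List.Vector (Fin 3) n)}
    (hA : TypeZero n A) : 2 + 1 ≤ Nat.card A.ConnectedComponent := by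
  have : Function.Injective fun i : Fin 3 => A.connectedComponentMk (outmost n i) := by
    intro i j hij
    by_contra hne
    exact hA i j hne (ConnectedComponent.eq.1 hij)
  simpa using Nat.card_le_card_of_injective _ this

end Words

/-! ### Assembly of the result. -/

theorem proposition4p12 :
    (∀ n : ℕ, 1 ≤ n →
      (numAcyclicOrientations (hanoiSchreier n) : ℤ) = at20 (hanoiH n)) ∧
    ∃ N M : ℕ → MvPolynomial (Fin 2) ℤ,
      (∀ n : ℕ, 1 ≤ n →
        (∀ k : Fin 3, hanoiH1 n k = (X 0 - 1) * N n) ∧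
        hanoiH0 n = (X 0 - 1) ^ 2 * M n) ∧
      (∀ n : ℕ, 1 ≤ n →
        at20 (hanoiH (n + 1)) =
          (2 * at20 (hanoiH n)) ^ 3 - 2 * (at20 (hanoiH2 n) + at20 (N n)) ^ 3) ∧
      (∀ n : ℕ, 1 ≤ n → ∀ h a m : ℤ,
        h = at20 (hanoiH2 n) → a = at20 (N n) → m = at20 (M n) →
        at20 (hanoiH2 (n + 1)) = 2 * h ^ 3 + 12 * h ^ 2 * a + 6 * h * a ^ 2 ∧
        at20 (N (n + 1)) =
          h ^ 3 + 11 * h ^ 2 * a + 4 * h ^ 2 * m + 28 * h * a ^ 2 + 8 * h * a * m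
            + 14 * a ^ 3 + 4 * a ^ 2 * m ∧
        at20 (M (n + 1)) =
          h ^ 3 + 21 * h ^ 2 * a + 12 * h ^ 2 * m + 120 * h * a ^ 2 + 120 * h * a * m
            + 24 * h * m ^ 2 + 172 * a ^ 3 + 204 * a ^ 2 * m + 72 * a * m ^ 2 + 8 * m ^ 3) ∧
      at20 (hanoiH2 1) = 2 ∧ at20 (N 1) = 1 ∧ at20 (M 1) = 1 := by
  refine ⟨fun n _ => numAcyclicOrientations_eq _, ?_⟩
  choose N hN using fun n => exists_partialTutte_eq_mul (hanoiSchreier_connected n)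
    (P := TypeOne n 0) fun _ => two_le_card_of_typeOne
  choose M hM using fun n => exists_partialTutte_eq_mul (hanoiSchreier_connected n)
    (P := TypeZero n) fun _ => three_le_card_of_typeZero
  have hN' : ∀ n, at20 (N n) = at20 (hanoiH1 n 0) := fun n => by
    rw [hanoiH1, hN]; simp [at20]
  have hM' : ∀ n, at20 (M n) = at20 (hanoiH0 n) := fun n => by
    rw [hanoiH0, hM]; simp [at20]
  refine ⟨N, M, fun n _ => ⟨fun k => ?_, hM n⟩, fun n _ => ?_, fun n _ h a m hh ha hm => ?_, ?_⟩
  · rw [hanoiH1_eq, hanoiH1, hN, pow_one]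
  · obtain ⟨h1, h2, h3⟩ := at20_hanoi_succ n rfl rfl rfl
    rw [at20_hanoiH, at20_hanoiH, h1, h2, h3, hN']
    -- Combinatorially, the three joining edges contribute `8`, or `8 - 2` if they close a cycle.
    -- The latter requires each copy to connect its two joined corners, which has weight `h + a` per
    -- copy.
    ring
  · rw [hN'] at ha ⊢
    rw [hM'] at hm ⊢
    exact at20_hanoi_succ n hh ha hm
  · rw [hN', hM']
    have h2 : 1 = at20 (hanoiH2 0) := by simp [at20_hanoiH2, stateSum_hanoiSchreier_zero]
    have h1 : 0 = at20 (hanoiH1 0 0) := by simp [at20_hanoiH1, stateSum_hanoiSchreier_zero]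
    have h0 : 0 = at20 (hanoiH0 0) := by simp [at20_hanoiH0, stateSum_hanoiSchreier_zero]
    -- At `h = 1`, `a = m = 0` only the coefficients `2`, `1`, `1` of `h ^ 3` survive.
    simpa using at20_hanoi_succ 0 h2 h1 h0
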